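/- Let $k>\ell\ge 2$ be integers. $H^{(k)}_{n,p,r}$ is the random coloured $k$-uniform hypergraph on $[n]$ in which each $k$-subset of $[n]$ is an edge independently with probability $p\in[0,1]$, and each edge independently receives a uniformly random colour from $[r]$. For $n$ divisible by $k-\ell$, an $\ell$-Hamilton cycle is a set of $n/(k-\ell)$ edges which, for some cyclic order of $[n]$, are sets of $k$ consecutive vertices, each starting $k-\ell$ places after the previous one, so that cyclically consecutive edges share exactly $\ell$ vertices; it is tight if $\ell=k-1$. It is rainbow if its edges have pairwise different colours, and a coloured hypergraph is rainbow $\ell$-Hamiltonian if it contains a rainbow $\ell$-Hamilton cycle. Throughout, $n\to\infty$ through the multiples of $k-\ell$, "whp" means with probability tending to $1$, $p=p(n)\in[0,1]$ is any sequence (the bounds below being assumed for all large such $n$), $c\ge 1/(k-\ell)$ is a constant, and $r=r(n)=cn$, where $cn$ is rounded up or down if it is not an integer (i.e. $r$ is an integer with $|r-cn|<1$). **Theorem 1.5.** Let $\varepsilon>0$ be fixed. (i) For all integers $k>\ell\ge2$ and $c\ge 1/(k-\ell)$, if $$p\le\begin{cases}(1-\varepsilon)\,\dfrac{e^{k-\ell+1}}{n^{k-\ell}}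 & \text{if } c=\frac1{k-\ell},\\[2mm](1-\varepsilon)\left(\dfrac{c-1/(k-\ell)}{c}\right)^{(k-\ell)c-1}\dfrac{e^{k-\ell+1}}{n^{k-\ell}} & \text{if } c>\frac1{k-\ell},\end{cases}$$ then whp $H^{(k)}_{n,p,r}$ is not rainbow $\ell$-Hamiltonian. (ii) For every $k$ there is a constant $K=K(k)>0$ such that, for all integers $\ell$ with $k>\ell\ge3$ and all $c\ge1/(k-\ell)$, if $p\ge K/n^{k-\ell}$, then whp $H^{(k)}_{n,p,r}$ is rainbow $\ell$-Hamiltonian. (iii) If $k>\ell=2$, $c\ge 1/(k-2)$ and $p\ge\omega/n^{k-2}$ for some $\omega=\omega(n)\to\infty$, then whp $H^{(k)}_{n,p,r}$ is rainbow $2$-Hamiltonian. (iv) For all $k\ge4$ and $c\ge1$ (and $\ell=k-1$), if $$p\ge\begin{cases}(1+\varepsilon)\,\dfrac{e^2}{n} & \text{if } c=1,\\[2mm](1+\varepsilon)\left(\dfrac{c-1}{c}\right)^{c-1}\dfrac{e^2}{n} & \text{if } c>1,\end{cases}$$ then whp $H^{(k)}_{n,p,r}$ is rainbow $(k-1)$-Hamiltonian,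 i.e. it contains a rainbow tight Hamilton cycle. Consequently, for $k\ge4$, $p^*=e^2/n$ (if $c=1$), respectively $p^*=\left(\frac{c-1}{c}\right)^{c-1}e^2/n$ (if $c>1$), is a sharp threshold for the existence of a rainbow tight Hamilton cycle in $H^{(k)}_{n,p,r}$: for every fixed $\varepsilon>0$, whp there is none if $p\le(1-\varepsilon)p^*$, and whp there is one if $p\ge(1+\varepsilon)p^*$. -/

import Mathlib

open Filter Topology MeasureTheory

/-- The `k`-element subsets of the vertex set `[n]`, modelled by `Fin n`. -/
abbrev KSet (k n : ℕ) : Type := {e : Finset (Fin n) // e.card = k}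

/-- A `k`-uniform hypergraph on `[n]` whose edges carry colours from `[r]`: every `k`-set carries a
Boolean (is it an edge?) and a colour. Only the colours of the edges are ever looked at. -/
abbrev ColoredHypergraph (k n r : ℕ) : Type := KSet k n → Bool × Fin r

/-- The `k`-set `e` is an edge of `H`. -/
def ColoredHypergraph.IsEdge {k n r : ℕ} (H : ColoredHypergraph k n r) (e : KSet k n) : Prop :=
  (H e).1 = true

/-- The colour of `e` in `H`. -/
def ColoredHypergraph.color {k n r : ℕ} (H : ColoredHypergraph k n r) (e : KSet k n) : Fin r :=
  (H e).2

/-- The law of the randomly coloured random hypergraph `H^{(k)}_{n,p,r}`: independently for each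
`k`-set, it is an edge with probability `p`, and its colour is independent of that and uniform on
`[r]`. It is a probability measure whenever `r ≥ 1`. -/
noncomputable def randomColoredHypergraph (k n r : ℕ) (p : unitInterval) :
    Measure (ColoredHypergraph k n r) :=
  Measure.pi fun _ : KSet k n =>
    (ProbabilityTheory.bernoulliMeasure true false p).prod
      (ProbabilityTheory.uniformOn (Set.univ : Set (Fin r)))

/-- The `k` consecutive vertices starting at position `s` in the cyclic order `σ` of `[n]`. -/
def cyclicArc {n : ℕ} (σ : ZMod n ≃ Fin n) (k s : ℕ) : Finset (Fin n) :=
  (Finset.range k).image fun j => σ ((s + j : ℕ) : ZMod n)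

/-- `C` is (the edge set of) an `ℓ`-Hamilton cycle in the complete `k`-uniform hypergraph on `[n]`:
it consists of `n / (k - ℓ)` sets `E i`, indexed cyclically, such that for some cyclic order of `[n]`
each `E i` consists of `k` consecutive vertices, each one starting `k - ℓ` positions after the
previous one, and consecutive ones have exactly `ℓ` common vertices. (The indices `i` run through
`ℕ`; since `k - ℓ` divides `n`, `E` is periodic with period `n / (k - ℓ)`.) -/
def IsHamiltonCycle {k n : ℕ} (ℓ : ℕ) (C : Finset (KSet k n)) : Prop :=
  (k - ℓ) ∣ n ∧ C.card = n / (k - ℓ) ∧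
    ∃ (σ : ZMod n ≃ Fin n) (E : ℕ → KSet k n),
      (∀ i, (E i : Finset (Fin n)) = cyclicArc σ k (i * (k - ℓ))) ∧
      (∀ i, ((E i : Finset (Fin n)) ∩ (E (i + 1) : Finset (Fin n))).card = ℓ) ∧
      C = (Finset.range (n / (k - ℓ))).image E

/-- `H` contains an `ℓ`-Hamilton cycle all of whose edges have different colours. -/
def RainbowHamiltonian {k n r : ℕ} (ℓ : ℕ) (H : ColoredHypergraph k n r) : Prop :=
  ∃ C : Finset (KSet k n), IsHamiltonCycle ℓ C ∧ (∀ e ∈ C, H.IsEdge e) ∧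
    Set.InjOn H.color (C : Set (KSet k n))

/-- `n → ∞` through the multiples of `d`. -/
def atTopMultiples (d : ℕ) : Filter ℕ := atTop ⊓ 𝓟 {n | d ∣ n}

/-- With high probability (as `n → ∞` through the multiples of `k - ℓ`), `H^{(k)}_{n,p,r}`, with
`p = p n` and `r = r n`, is rainbow `ℓ`-Hamiltonian. -/
def WhpRainbow (k ℓ : ℕ) (r : ℕ → ℕ) (p : ℕ → unitInterval) : Prop :=
  Tendsto (fun n => (randomColoredHypergraph k n (r n) (p n)).real {H | RainbowHamiltonian ℓ H})
    (atTopMultiples (k - ℓ)) (𝓝 1)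

/-- With high probability (as `n → ∞` through the multiples of `k - ℓ`), `H^{(k)}_{n,p,r}`, with
`p = p n` and `r = r n`, is not rainbow `ℓ`-Hamiltonian. -/
def WhpNotRainbow (k ℓ : ℕ) (r : ℕ → ℕ) (p : ℕ → unitInterval) : Prop :=
  Tendsto (fun n => (randomColoredHypergraph k n (r n) (p n)).real {H | ¬ RainbowHamiltonian ℓ H})
    (atTopMultiples (k - ℓ)) (𝓝 1)

/-- `r = c n`, where `c n` is rounded, in either direction, to an integer where it is not one
(if `c n` is an integer, then `r n = c n`). -/
def IsColorCount (d : ℕ) (c : ℝ) (r : ℕ → ℕ) : Prop :=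
  ∀ᶠ n in atTopMultiples d, |(r n : ℝ) - c * n| < 1

/-- `q` is a sharp threshold for rainbow `ℓ`-Hamiltonicity of `H^{(k)}_{n,p,r}`. -/
def IsSharpThreshold (k ℓ : ℕ) (r : ℕ → ℕ) (q : ℕ → ℝ) : Prop :=
  ∀ ε : ℝ, 0 < ε → ∀ p : ℕ → unitInterval,
    ((∀ᶠ n in atTopMultiples (k - ℓ), (p n : ℝ) ≤ (1 - ε) * q n) → WhpNotRainbow k ℓ r p) ∧
    ((∀ᶠ n in atTopMultiples (k - ℓ), (1 + ε) * q n ≤ (p n : ℝ)) → WhpRainbow k ℓ r p)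

/-- The first-moment threshold for rainbow `ℓ`-Hamilton cycles with `c n` colours. -/
noncomputable def rainbowThreshold (k ℓ : ℕ) (c : ℝ) (n : ℕ) : ℝ :=
  if c = 1 / ((k : ℝ) - ℓ) then
    Real.exp ((k : ℝ) - ℓ + 1) / (n : ℝ) ^ (k - ℓ)
  else
    ((c - 1 / ((k : ℝ) - ℓ)) / c) ^ (((k : ℝ) - ℓ) * c - 1) *
      Real.exp ((k : ℝ) - ℓ + 1) / (n : ℝ) ^ (k - ℓ)

/-- The threshold for rainbow tight Hamilton cycles with `c n` colours. -/
noncomputable def tightThreshold (c : ℝ) (n : ℕ) : ℝ :=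
  if c = 1 then Real.exp 2 / n
  else ((c - 1) / c) ^ (c - 1) * Real.exp 2 / n

/-! ### Factorial estimates -/

/-! Write d = k - ℓ and m = n/d, and let (r)_m be the falling factorial. A fixed Hamilton cycle is a
rainbow subgraph with probability (r)_m (p/r)^m (`measureReal_rainbowEvent`), and (r)_m / r^m =
exp(m(R - 1 + o(1))) with R = `rainbowRate d c` (`eventually_log_descFactorial_div_pow`). At most n!
cycles exist, one for each labelled cyclic order, so the expected number is at most about (n/e)^n
p^m exp(m(R - 1)). This decays exponentially once p is below e^(d+1-R)/n^d by a constant factor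
(`whpNotRainbow_of_le`). By `rainbowThreshold_eq`, that value is the stated threshold in both cases
for c.

The positive parts use the second moment, over all labelled cyclic orders. If two cycles share b
edges, the joint probability is at most the product of the two probabilities times (κ/p)^b, where κ
bounds the m-th root of r^m/(r)_m (`measureReal_rainbowEvent_inter_le_mul`). The ratio of E[X^2] to
E[X]^2 is therefore at most the average of y^(number of preserved arcs), with y = κ/p, over the
permutations π of ℤ/n, an arc being preserved if π maps it to an aligned arc. It suffices that this
average tends to 1.

To bound the average, the cyclic pattern of preserved arcs is cut at a long gap
(`pow_card_le_sum_powerset`); patterns without such a gap are so large that they are paid for by an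
exponentially small factor. The permutations preserving a linear pattern T are counted arc by arc.
Each further arc multiplies the weight by a factor that depends only on its distance g from the
previous arc, and the renewal inequality `sum_powerset_le_of_renewal` sums over all T as soon as
these factors add up to less than 1.

The factor for g = 1 is y A (e/n)^d. Arcs that overlap the previous one with g ≥ 2 gain another e/n,
and the disjoint arcs together contribute O(n^2/n^ℓ) times the main term. This is negligible for ℓ ≥
3 and bounded for ℓ = 2, where p n^d → ∞ compensates. For tight cycles A = 1, because an arc that
shares k - 1 given points with a given arc is determined. With the optimal κ ≈ e^(1-R), the
condition on p then agrees with the first moment threshold, which makes it sharp. -/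

lemma succ_pow_mul_exp_le (N : ℕ) :
    ((N : ℝ) + 1) ^ (N + 2) * Real.exp 1 ≤ ((N : ℝ) + 2) ^ (N + 2) := by
  have hN : (0 : ℝ) < (N : ℝ) + 2 := by positivity
  have h1 : ((N : ℝ) + 1) ≤ ((N : ℝ) + 2) * Real.exp (-1 / ((N : ℝ) + 2)) := by
    have := Real.add_one_le_exp (-1 / ((N : ℝ) + 2))
    have h2 := mul_le_mul_of_nonneg_left this hN.le
    refine le_trans (le_of_eq ?_) h2
    field_simp
    ring
  have h3 : ((N : ℝ) + 1) ^ (N + 2) ≤ ((N : ℝ) + 2) ^ (N + 2) * Real.exp (-1) := by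
    refine (pow_le_pow_left₀ (by positivity) h1 _).trans (le_of_eq ?_)
    rw [mul_pow, ← Real.exp_nat_mul]
    congr 2
    push_cast
    field_simp
  calc _ ≤ ((N : ℝ) + 2) ^ (N + 2) * Real.exp (-1) * Real.exp 1 := by gcongr
    _ = _ := by rw [mul_assoc, ← Real.exp_add]; simp

/-- Stirling's upper bound up to a polynomial factor; only the exponential rate matters later. -/
lemma factorial_succ_mul_exp_le (N : ℕ) :
    ((N + 1).factorial : ℝ) * Real.exp N ≤ ((N : ℝ) + 1) ^ (N + 2) := by
  induction N with
  | zero => simp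
  | succ N ih =>
    have h := succ_pow_mul_exp_le N
    rw [Nat.factorial_succ]
    push_cast
    rw [Real.exp_add]
    calc ((N : ℝ) + 1 + 1) * ((N + 1).factorial : ℝ) * (Real.exp N * Real.exp 1)
        = ((N : ℝ) + 2) * (((N + 1).factorial : ℝ) * Real.exp N) * Real.exp 1 := by ring
      _ ≤ ((N : ℝ) + 2) * ((N : ℝ) + 1) ^ (N + 2) * Real.exp 1 := by gcongr
      _ = ((N : ℝ) + 2) * (((N : ℝ) + 1) ^ (N + 2) * Real.exp 1) := by ring
      _ ≤ ((N : ℝ) + 2) * ((N : ℝ) + 2) ^ (N + 2) := by gcongr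
      _ = _ := by ring

lemma factorial_mul_exp_le (N : ℕ) :
    (N.factorial : ℝ) * Real.exp N ≤ Real.exp 1 * ((N : ℝ) + 1) * (N : ℝ) ^ N := by
  cases N with
  | zero => simp
  | succ N =>
    have h := factorial_succ_mul_exp_le N
    push_cast
    rw [Real.exp_add]
    have h2 : (0 : ℝ) ≤ Real.exp 1 * ((N : ℝ) + 1) ^ (N + 1) := by positivity
    calc ((N + 1).factorial : ℝ) * (Real.exp N * Real.exp 1)
        = (((N + 1).factorial : ℝ) * Real.exp N) * Real.exp 1 := by ring
      _ ≤ ((N : ℝ) + 1) ^ (N + 2) * Real.exp 1 := by gcongr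
      _ ≤ _ := by ring_nf at h2 ⊢; linarith

/-- Induction on v, where (1 + 1/n)^v ≤ e because v ≤ n. With n = r and v = m, it says that κ = e is
admissible for every number r ≥ m of colours. -/
lemma pow_le_exp_mul_descFactorial {n v : ℕ} (h : v ≤ n) :
    (n : ℝ) ^ v ≤ Real.exp v * n.descFactorial v := by
  induction v generalizing n with
  | zero => simp
  | succ v ih =>
    obtain ⟨n, rfl⟩ : ∃ n', n = n' + 1 := ⟨n - 1, by omega⟩
    have hv : v ≤ n := by omega
    have ih := ih hv
    rw [Nat.succ_descFactorial_succ]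
    push_cast
    rw [Real.exp_add]
    rcases Nat.eq_zero_or_pos n with rfl | hn
    · obtain rfl : v = 0 := by omega
      simp
    have hn' : (0 : ℝ) < n := by exact_mod_cast hn
    have h1 : ((n : ℝ) + 1) ≤ n * Real.exp (1 / n) := by
      have := mul_le_mul_of_nonneg_left (Real.add_one_le_exp (1 / (n : ℝ))) hn'.le
      refine le_trans (le_of_eq ?_) this
      field_simp
      ring
    have h2 : ((n : ℝ) + 1) ^ v ≤ (n : ℝ) ^ v * Real.exp 1 := by
      refine (pow_le_pow_left₀ (by positivity) h1 _).trans ?_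
      rw [mul_pow, ← Real.exp_nat_mul]
      gcongr
      rw [mul_one_div, div_le_one hn']
      exact_mod_cast hv
    calc ((n : ℝ) + 1) ^ (v + 1) = ((n : ℝ) + 1) ^ v * (n + 1) := by ring
      _ ≤ (n : ℝ) ^ v * Real.exp 1 * (n + 1) := by gcongr
      _ ≤ (Real.exp v * n.descFactorial v) * Real.exp 1 * (n + 1) := by gcongr
      _ = _ := by ring

lemma pow_self_le_exp_mul_factorial (n : ℕ) :
    (n : ℝ) ^ n ≤ Real.exp n * n.factorial := by
  simpa [Nat.descFactorial_self] using pow_le_exp_mul_descFactorial (le_refl n)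

lemma factorial_sub_le {n v : ℕ} (h : v ≤ n) (hn : 0 < n) :
    ((n - v).factorial : ℝ) ≤ (Real.exp 1 / n) ^ v * n.factorial := by
  have h1 := pow_le_exp_mul_descFactorial h
  have h2 : (n.factorial : ℝ) = (n - v).factorial * n.descFactorial v := by
    exact_mod_cast (Nat.factorial_mul_descFactorial h).symm
  have hn' : (0 : ℝ) < n := by exact_mod_cast hn
  rw [div_pow, ← Real.exp_nat_mul, mul_one, h2, div_mul_eq_mul_div, le_div_iff₀ (by positivity)]
  calc ((n - v).factorial : ℝ) * (n : ℝ) ^ v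
      ≤ (n - v).factorial * (Real.exp v * n.descFactorial v) := by gcongr
    _ = _ := by ring

/-- The factors r/(r - i) of r^b/(r)_b increase with i, so their geometric mean over i < b is at
most that over i < m. In the downward induction, a failure at b forces κ(r - b) < r and hence a
failure at b + 1. -/
lemma pow_le_pow_mul_descFactorial_of_le {r m : ℕ} {κ : ℝ} (hκ : 0 ≤ κ) (hmr : m ≤ r)
    (h : (r : ℝ) ^ m ≤ κ ^ m * r.descFactorial m) {b : ℕ} (hb : b ≤ m) :
    (r : ℝ) ^ b ≤ κ ^ b * r.descFactorial b := by
  induction hb using Nat.decreasingInduction with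
  | self => exact h
  | of_succ b hb ih =>
    by_contra hlt
    push Not at hlt
    have hbr : b ≤ r := by omega
    have h1 : ((r - b : ℕ) : ℝ) ^ b ≤ r.descFactorial b := by
      have := Nat.pow_sub_le_descFactorial r b
      refine le_trans ?_ (Nat.cast_le.mpr this)
      push_cast
      gcongr
      omega
    have h2 : (κ * ((r - b : ℕ) : ℝ)) ^ b < (r : ℝ) ^ b := by
      rw [mul_pow]
      exact lt_of_le_of_lt (by gcongr) hlt
    have h3 : κ * ((r - b : ℕ) : ℝ) < r := lt_of_pow_lt_pow_left₀ b (by positivity) h2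
    have h4 : (0 : ℝ) ≤ κ ^ b * r.descFactorial b := by positivity
    have h5 : (0 : ℝ) ≤ κ * ((r - b : ℕ) : ℝ) := by positivity
    have : κ ^ (b + 1) * r.descFactorial (b + 1) < (r : ℝ) ^ (b + 1) := by
      rw [Nat.descFactorial_succ]
      push_cast
      calc κ ^ (b + 1) * (((r - b : ℕ) : ℝ) * r.descFactorial b)
          = (κ ^ b * r.descFactorial b) * (κ * ((r - b : ℕ) : ℝ)) := by ring
        _ < (r : ℝ) ^ b * r := by
            exact mul_lt_mul'' hlt h3 h4 h5
        _ = _ := by ring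
    linarith

/-! ### Rainbow colourings: the exponential rate -/

/-- The exponential rate, up to the additive constant `-1`, of the probability that `n / d` edges
receive different colours, when `c n` colours are available. -/
noncomputable def rainbowRate (d : ℕ) (c : ℝ) : ℝ :=
  (d * c - 1) * (Real.log c - Real.log (c - 1 / d))

/-- The estimate N log N - N ≤ log N! ≤ N log N - N + 1 + log(N + 1), applied to N = r and N = r -
m. For r = m the convention log 0 = 0 is harmless, as the factor r - m vanishes. -/
lemma log_descFactorial_div_pow_bounds {r m : ℕ} (hm : m ≤ r) (hr : 0 < r) :
    |Real.log (r.descFactorial m / (r : ℝ) ^ m) + m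
      - ((r - m : ℕ) : ℝ) * (Real.log r - Real.log ((r - m : ℕ) : ℝ))| ≤
      1 + Real.log (r + 1) := by
  set s := r - m with hs
  have hrm : (r : ℝ) = s + m := by rw [hs]; push_cast [hm]; ring
  have hr' : (0 : ℝ) < r := by exact_mod_cast hr
  have hD : (0 : ℝ) < r.descFactorial m := by
    exact_mod_cast Nat.pos_of_ne_zero (by rw [Ne, Nat.descFactorial_eq_zero_iff_lt]; omega)
  have hfac : (r.factorial : ℝ) = s.factorial * r.descFactorial m := by
    exact_mod_cast (Nat.factorial_mul_descFactorial hm).symm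
  have lb : ∀ N : ℕ, (N : ℝ) * Real.log N ≤ N + Real.log N.factorial := by
    intro N
    rcases Nat.eq_zero_or_pos N with rfl | hN
    · simp
    have hN' : (0 : ℝ) < N := by exact_mod_cast hN
    have := Real.log_le_log (by positivity) (pow_self_le_exp_mul_factorial N)
    rwa [Real.log_pow, Real.log_mul (by positivity) (by positivity), Real.log_exp] at this
  have ub : ∀ N : ℕ, Real.log N.factorial + N ≤ 1 + Real.log (N + 1) + N * Real.log N := by
    intro N
    rcases Nat.eq_zero_or_pos N with rfl | hN
    · simp
    have hN' : (0 : ℝ) < N := by exact_mod_cast hN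
    have := Real.log_le_log (by positivity) (factorial_mul_exp_le N)
    rwa [Real.log_mul (by positivity) (by positivity), Real.log_mul (by positivity) (by positivity),
      Real.log_mul (by positivity) (by positivity), Real.log_exp, Real.log_exp,
      Real.log_pow] at this
  have hlog : Real.log r.factorial = Real.log s.factorial + Real.log (r.descFactorial m) := by
    rw [hfac, Real.log_mul (by positivity) hD.ne']
  have h4 : Real.log ((s : ℝ) + 1) ≤ Real.log (r + 1) := by
    apply Real.log_le_log (by positivity)
    have : (0 : ℝ) ≤ m := by positivity
    linarith
  rw [Real.log_div hD.ne' (by positivity), Real.log_pow]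
  have e : (r : ℝ) * Real.log r = s * Real.log r + m * Real.log r := by rw [hrm]; ring
  have h1 := lb r
  have h2 := ub r
  have h3 := lb s
  have h5 := ub s
  rw [abs_le]
  constructor <;> nlinarith

/-! ### Probabilities in the random coloured hypergraph -/

instance randomColoredHypergraph_isProbabilityMeasure (k n r : ℕ) [NeZero r] (p : unitInterval) :
    IsProbabilityMeasure (randomColoredHypergraph k n r p) := by
  unfold randomColoredHypergraph
  infer_instance

lemma randomColoredHypergraph_measureReal_box (k n r : ℕ) [NeZero r] (p : unitInterval)
    (S : Finset (KSet k n)) (g : KSet k n → Fin r) :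
    (randomColoredHypergraph k n r p).real {H | ∀ e ∈ S, H e = (true, g e)} =
      ((p : ℝ) / r) ^ S.card := by
  classical
  have hset : {H : ColoredHypergraph k n r | ∀ e ∈ S, H e = (true, g e)} =
      Set.univ.pi fun e => if e ∈ S then {(true, g e)} else Set.univ := by
    ext H
    simp only [Set.mem_ofPred_eq, Set.mem_pi, Set.mem_univ, forall_const]
    refine forall_congr' fun e => ?_
    by_cases h : e ∈ S <;> simp [h]
  rw [hset, measureReal_def, randomColoredHypergraph, Measure.pi_pi, ENNReal.toReal_prod]
  rw [← Finset.prod_subset (Finset.subset_univ S), Finset.prod_congr rfl (g := fun _ => (p : ℝ) / r)]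
  · simp [div_pow]
  · intro e he
    rw [if_pos he, ← Set.singleton_prod_singleton, Measure.prod_prod, ENNReal.toReal_mul,
      ← measureReal_def, ProbabilityTheory.bernoulliMeasure_real_apply_of_mem_of_notMem p
        (MeasurableSet.singleton _) rfl (by simp),
      ProbabilityTheory.uniformOn_univ, Measure.count_singleton]
    simp [div_eq_mul_inv]
  · intro e _ he
    rw [if_neg he]
    simp

lemma randomColoredHypergraph_measureReal_edges_color (k n r : ℕ) [NeZero r] (p : unitInterval)
    (S : Finset (KSet k n)) (Q : Finset (S → Fin r)) :
    (randomColoredHypergraph k n r p).real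
      {H | (∀ e ∈ S, H.IsEdge e) ∧ (fun e : S => H.color e) ∈ Q} =
      Q.card * ((p : ℝ) / r) ^ S.card := by
  classical
  have hset : {H : ColoredHypergraph k n r | (∀ e ∈ S, H.IsEdge e) ∧ (fun e : S => H.color e) ∈ Q} =
      ⋃ f ∈ Q, {H | ∀ e ∈ S, H e = (true, if h : e ∈ S then f ⟨e, h⟩ else 0)} := by
    ext H
    simp only [Set.mem_ofPred_eq, Set.mem_iUnion, exists_prop]
    constructor
    · rintro ⟨h1, h2⟩
      refine ⟨_, h2, fun e he => ?_⟩
      rw [dif_pos he]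
      exact Prod.ext (h1 e he) rfl
    · rintro ⟨f, hf, h⟩
      refine ⟨fun e he => by simp [ColoredHypergraph.IsEdge, h e he], ?_⟩
      convert hf using 1
      funext e
      simp [ColoredHypergraph.color, h e e.2]
  rw [hset, measureReal_biUnion_finset _ (fun _ _ => (Set.toFinite _).measurableSet)]
  · rw [Finset.sum_congr rfl fun f _ => randomColoredHypergraph_measureReal_box k n r p S
      (fun e => if h : e ∈ S then f ⟨e, h⟩ else 0), Finset.sum_const, nsmul_eq_mul]
  · intro f _ f' _ hff
    refine Set.disjoint_left.mpr fun H h1 h2 => hff ?_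
    funext e
    have := (h1 e e.2).symm.trans (h2 e e.2)
    simpa using this

/-- The event that `C` is a rainbow set of edges. -/
def rainbowEvent {k n : ℕ} (r : ℕ) (C : Finset (KSet k n)) : Set (ColoredHypergraph k n r) :=
  {H | (∀ e ∈ C, H.IsEdge e) ∧ Set.InjOn H.color (C : Set (KSet k n))}

lemma measureReal_rainbowEvent {k n : ℕ} (r : ℕ) [NeZero r] (p : unitInterval)
    (C : Finset (KSet k n)) :
    (randomColoredHypergraph k n r p).real (rainbowEvent r C) =
      r.descFactorial C.card * ((p : ℝ) / r) ^ C.card := by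
  classical
  have h := randomColoredHypergraph_measureReal_edges_color k n r p C
    (Finset.univ.filter Function.Injective)
  have hcard : (Finset.univ.filter (Function.Injective : (C → Fin r) → Prop)).card =
      r.descFactorial C.card := by
    rw [← Fintype.card_subtype, Fintype.card_congr (Equiv.subtypeInjectiveEquivEmbedding C (Fin r)),
      Fintype.card_embedding_eq]
    simp
  rw [hcard] at h
  rw [← h]
  congr 1
  ext H
  simp only [rainbowEvent, Set.mem_ofPred_eq, Finset.mem_filter, Finset.mem_univ, true_and]
  refine and_congr Iff.rfl ?_
  exact Set.injOn_iff_injective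

/-- Colour C injectively; then D \ C must be coloured injectively while avoiding the |C ∩ D| colours
already used on C ∩ D. -/
lemma card_colorings_injOn_le {α : Type*} [DecidableEq α] (r : ℕ) (C D : Finset α) :
    Nat.card {f : (C ∪ D : Finset α) → Fin r //
      (∀ x y : (C ∪ D : Finset α), x.1 ∈ C → y.1 ∈ C → f x = f y → x = y) ∧
      (∀ x y : (C ∪ D : Finset α), x.1 ∈ D → y.1 ∈ D → f x = f y → x = y)} ≤
    r.descFactorial C.card * (r - (C ∩ D).card).descFactorial (D \ C).card := by
  classical
  let im : (C ↪ Fin r) → Finset (Fin r) := fun f =>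
    Finset.univ.image fun x : (C ∩ D : Finset α) => f ⟨x, (Finset.mem_inter.mp x.2).1⟩
  have him : ∀ f, (im f).card = (C ∩ D).card := by
    intro f
    rw [Finset.card_image_of_injective]
    · simp
    · intro x y h
      have h2 := Subtype.ext_iff.mp (f.injective h)
      exact Subtype.ext h2
  let F : {f : (C ∪ D : Finset α) → Fin r //
      (∀ x y : (C ∪ D : Finset α), x.1 ∈ C → y.1 ∈ C → f x = f y → x = y) ∧
      (∀ x y : (C ∪ D : Finset α), x.1 ∈ D → y.1 ∈ D → f x = f y → x = y)} →
      (Σ f : C ↪ Fin r, ((D \ C : Finset α) ↪ {c : Fin r // c ∉ im f})) := fun f =>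
    ⟨⟨fun x => f.1 ⟨x, Finset.mem_union_left _ x.2⟩, fun x y h => by
        have := f.2.1 ⟨x, Finset.mem_union_left _ x.2⟩ ⟨y, Finset.mem_union_left _ y.2⟩ x.2 y.2 h
        have h2 := Subtype.ext_iff.mp this; exact Subtype.ext h2⟩,
      ⟨fun x => ⟨f.1 ⟨x, Finset.mem_union_right _ (Finset.mem_sdiff.mp x.2).1⟩, by
          intro hx
          simp only [im, Finset.mem_image, Finset.mem_univ, true_and] at hx
          obtain ⟨z, hz⟩ := hx
          have hz1 := Finset.mem_inter.mp z.2
          have := f.2.2 ⟨z, Finset.mem_union_left _ hz1.1⟩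
            ⟨x, Finset.mem_union_right _ (Finset.mem_sdiff.mp x.2).1⟩ hz1.2
            (Finset.mem_sdiff.mp x.2).1 hz
          have h2 : (z : α) = x := congrArg Subtype.val this
          exact (Finset.mem_sdiff.mp x.2).2 (h2 ▸ hz1.1)⟩, fun x y h => by
          have h' := Subtype.ext_iff.mp h
          have := f.2.2 ⟨x, Finset.mem_union_right _ (Finset.mem_sdiff.mp x.2).1⟩
            ⟨y, Finset.mem_union_right _ (Finset.mem_sdiff.mp y.2).1⟩
            (Finset.mem_sdiff.mp x.2).1 (Finset.mem_sdiff.mp y.2).1 h'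
          have h2 := Subtype.ext_iff.mp this; exact Subtype.ext h2⟩⟩
  have hF : Function.Injective F := by
    intro f g h
    have h1 : ∀ x : C, (F f).1 x = (F g).1 x := fun x => by rw [h]
    have h2 : ∀ x : (D \ C : Finset α), ((F f).2 x : Fin r) = (F g).2 x := fun x => by rw [h]
    apply Subtype.ext
    funext ⟨x, hx⟩
    by_cases hxC : x ∈ C
    · exact h1 ⟨x, hxC⟩
    · exact h2 ⟨x, by
        rw [Finset.mem_sdiff]
        exact ⟨(Finset.mem_union.mp hx).resolve_left hxC, hxC⟩⟩
  refine (Nat.card_le_card_of_injective F hF).trans (le_of_eq ?_)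
  rw [Nat.card_eq_fintype_card, Fintype.card_sigma]
  have : ∀ f : C ↪ Fin r, Fintype.card ((D \ C : Finset α) ↪ {c : Fin r // c ∉ im f}) =
      (r - (C ∩ D).card).descFactorial (D \ C).card := by
    intro f
    rw [Fintype.card_embedding_eq, Fintype.card_coe, Fintype.card_subtype_compl]
    simp [him]
  simp only [this]
  simp [Fintype.card_embedding_eq]

lemma measureReal_rainbowEvent_inter_le {k n : ℕ} (r : ℕ) [NeZero r] (p : unitInterval)
    (C D : Finset (KSet k n)) :
    (randomColoredHypergraph k n r p).real (rainbowEvent r C ∩ rainbowEvent r D) ≤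
      r.descFactorial C.card * (r - (C ∩ D).card).descFactorial (D \ C).card *
        ((p : ℝ) / r) ^ (C ∪ D).card := by
  classical
  have h := randomColoredHypergraph_measureReal_edges_color k n r p (C ∪ D)
    (Finset.univ.filter fun f : (C ∪ D : Finset (KSet k n)) → Fin r =>
      (∀ x y : (C ∪ D : Finset _), x.1 ∈ C → y.1 ∈ C → f x = f y → x = y) ∧
      (∀ x y : (C ∪ D : Finset _), x.1 ∈ D → y.1 ∈ D → f x = f y → x = y))
  rw [← Fintype.card_subtype, ← Nat.card_eq_fintype_card] at h
  have hp : 0 ≤ (p : ℝ) / r := div_nonneg p.2.1 (Nat.cast_nonneg _)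
  calc _ ≤ _ := measureReal_mono ?_
    _ = _ := h
    _ ≤ _ := by
      gcongr
      exact_mod_cast card_colorings_injOn_le r C D
  rintro H ⟨⟨h1, h2⟩, ⟨h3, h4⟩⟩
  simp only [Set.mem_ofPred_eq, Finset.mem_filter, Finset.mem_univ, true_and]
  refine ⟨fun e he => (Finset.mem_union.mp he).elim (h1 e) (h3 e), fun x y hx hy hxy => ?_,
    fun x y hx hy hxy => ?_⟩
  · exact Subtype.ext (h2 hx hy hxy)
  · exact Subtype.ext (h4 hx hy hxy)

/-- With b common edges, (r)_m = (r)_b (r - b)_(m-b). The joint bound is therefore the squared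
single probability times r^b/((r)_b p^b), and r^b ≤ κ^b (r)_b. -/
lemma measureReal_rainbowEvent_inter_le_mul {k n m : ℕ} {r : ℕ} [NeZero r] {p : unitInterval}
    (hp : 0 < (p : ℝ)) {κ : ℝ} (hκ : 0 ≤ κ) (hmr : m ≤ r)
    (h : (r : ℝ) ^ m ≤ κ ^ m * r.descFactorial m)
    {C D : Finset (KSet k n)} (hC : C.card = m) (hD : D.card = m) :
    (randomColoredHypergraph k n r p).real (rainbowEvent r C ∩ rainbowEvent r D) ≤
      (r.descFactorial m * ((p : ℝ) / r) ^ m) ^ 2 * (κ / p) ^ (C ∩ D).card := by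
  refine (measureReal_rainbowEvent_inter_le r p C D).trans ?_
  set b := (C ∩ D).card with hb
  have hbm : b ≤ m := hC ▸ Finset.card_le_card Finset.inter_subset_left
  have h1 : (D \ C).card = m - b := by
    rw [Finset.card_sdiff, hD, hb]
  have h2 : (C ∪ D).card = m + (m - b) := by
    have := Finset.card_union_add_card_inter C D
    omega
  have h3 := pow_le_pow_mul_descFactorial_of_le hκ hmr h hbm
  have h4 : (r.descFactorial m : ℝ) = r.descFactorial b * (r - b).descFactorial (m - b) := by
    rw [mul_comm]
    exact_mod_cast (Nat.descFactorial_mul_descFactorial hbm).symm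
  have hr : (0 : ℝ) < r := by exact_mod_cast Nat.pos_of_ne_zero (NeZero.ne r)
  rw [h1, h2, hC]
  set a : ℝ := (r.descFactorial m : ℝ) * ((p : ℝ) / r) ^ m with ha
  have ha0 : 0 ≤ a := by positivity
  -- Both sides carry the extra factor (p/r)^b, so that the exponents m - b and b recombine to m; it
  -- is cancelled in `h6`.
  have h5 : ((r - b).descFactorial (m - b) : ℝ) * ((p : ℝ) / r) ^ (m - b) * ((p : ℝ) / r) ^ b ≤
      a * (κ / p) ^ b * ((p : ℝ) / r) ^ b := by
    have e1 : ((p : ℝ) / r) ^ m = ((p : ℝ) / r) ^ (m - b) * ((p : ℝ) / r) ^ b := by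
      rw [← pow_add]; congr 1; omega
    have e2 : (κ / p) ^ b * ((p : ℝ) / r) ^ b = κ ^ b / (r : ℝ) ^ b := by
      rw [← mul_pow, ← div_pow]; congr 1; field_simp
    rw [mul_assoc, ← e1, mul_assoc, e2, ha, h4]
    have e3 : (1 : ℝ) ≤ κ ^ b * r.descFactorial b / (r : ℝ) ^ b := by
      rw [le_div_iff₀ (by positivity)]; simpa using h3
    calc ((r - b).descFactorial (m - b) : ℝ) * ((p : ℝ) / r) ^ m
        ≤ ((r - b).descFactorial (m - b) : ℝ) * ((p : ℝ) / r) ^ m *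
          (κ ^ b * r.descFactorial b / (r : ℝ) ^ b) := le_mul_of_one_le_right (by positivity) e3
      _ = _ := by ring
  have h6 : ((r - b).descFactorial (m - b) : ℝ) * ((p : ℝ) / r) ^ (m - b) ≤ a * (κ / p) ^ b :=
    le_of_mul_le_mul_right h5 (by positivity)
  calc _ = a * (((r - b).descFactorial (m - b) : ℝ) * ((p : ℝ) / r) ^ (m - b)) := by
        rw [ha, pow_add]; ring
    _ ≤ a * (a * (κ / p) ^ b) := by gcongr
    _ = _ := by ring

/-- The second moment method for a union of events. -/
lemma two_sub_le_measureReal_iUnion {Ω ι : Type*} [MeasurableSpace Ω] (μ : Measure Ω)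
    [IsProbabilityMeasure μ] [Fintype ι] {A : ι → Set Ω} (hA : ∀ i, MeasurableSet (A i))
    (hs : 0 < ∑ i, μ.real (A i)) :
    2 - (∑ i, ∑ j, μ.real (A i ∩ A j)) / (∑ i, μ.real (A i)) ^ 2 ≤ μ.real (⋃ i, A i) := by
  classical
  set s := ∑ i, μ.real (A i) with hsdef
  let X : Ω → ℝ := fun ω => ∑ i, (A i).indicator 1 ω
  have hint : ∀ B : Set Ω, MeasurableSet B → Integrable (B.indicator (1 : Ω → ℝ)) μ := fun B hB =>
    (integrable_indicator_iff hB).2 (integrable_const (1 : ℝ)).integrableOn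
  have hX : Integrable X μ := integrable_finsetSum _ fun i _ => hint _ (hA i)
  have hX2eq : ∀ ω, X ω ^ 2 = ∑ i, ∑ j, (A i ∩ A j).indicator 1 ω := by
    intro ω
    simp only [X, sq, Finset.sum_mul_sum]
    refine Finset.sum_congr rfl fun i _ => Finset.sum_congr rfl fun j _ => ?_
    rw [Set.inter_indicator_one]
    rfl
  have hX2 : Integrable (fun ω => X ω ^ 2) μ := by
    simp only [hX2eq]
    exact integrable_finsetSum _ fun i _ => integrable_finsetSum _ fun j _ =>
      hint _ ((hA i).inter (hA j))
  have e1 : ∫ ω, X ω ∂μ = s := by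
    rw [integral_finsetSum _ fun i _ => hint _ (hA i)]
    exact Finset.sum_congr rfl fun i _ => integral_indicator_one (hA i)
  have e2 : ∫ ω, X ω ^ 2 ∂μ = ∑ i, ∑ j, μ.real (A i ∩ A j) := by
    simp only [hX2eq]
    rw [integral_finsetSum _ fun i _ => integrable_finsetSum _ fun j _ =>
      hint _ ((hA i).inter (hA j))]
    refine Finset.sum_congr rfl fun i _ => ?_
    rw [integral_finsetSum _ fun j _ => hint _ ((hA i).inter (hA j))]
    exact Finset.sum_congr rfl fun j _ => integral_indicator_one ((hA i).inter (hA j))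
  have hU : MeasurableSet (⋃ i, A i) := MeasurableSet.iUnion hA
  -- The integrand is 1 - (1 - X/s)^2: it is at most 1 everywhere and 0 where X = 0, hence it lies
  -- below the indicator of the union.
  have key : ∫ ω, (2 / s * X ω - (1 / s ^ 2) * X ω ^ 2) ∂μ ≤
      ∫ ω, (⋃ i, A i).indicator (1 : Ω → ℝ) ω ∂μ := by
    refine integral_mono ((hX.const_mul _).sub (hX2.const_mul _)) (hint _ hU) fun ω => ?_
    by_cases h : ω ∈ ⋃ i, A i
    · rw [Set.indicator_of_mem h]
      have : 0 ≤ (1 - X ω / s) ^ 2 := sq_nonneg _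
      simp only [Pi.one_apply]
      have e : (1 - X ω / s) ^ 2 = 1 - (2 / s * X ω - (1 / s ^ 2) * X ω ^ 2) := by
        field_simp
        ring
      linarith
    · rw [Set.indicator_of_notMem h]
      have : X ω = 0 := Finset.sum_eq_zero fun i _ =>
        Set.indicator_of_notMem (fun hi => h (Set.mem_iUnion_of_mem i hi)) _
      simp [this]
  rw [integral_sub (hX.const_mul _) (hX2.const_mul _), integral_const_mul, integral_const_mul,
    e1, e2, integral_indicator_one hU] at key
  refine le_trans (le_of_eq ?_) key
  field_simp

/-! ### A renewal inequality for sums over finite sets -/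

/-- Each T ⊆ [0, N) is weighted by the fraction of its mass not yet reserved for a next element
below N. This total does not increase with N: the new set T ∪ {N} has mass at most f(N - max T)
w(T), exactly what the factor of T loses. At N = 1 the total is w({0}), and every factor is at least
1 - F. Here `T.sup id` is max T. -/
lemma sum_powerset_le_of_renewal {w : Finset ℕ → ℝ} {f : ℕ → ℝ} {F : ℝ} {M : ℕ}
    (hM : 1 ≤ M) (hw : ∀ T, 0 ≤ w T) (hf : ∀ g, 0 ≤ f g)
    (hstep : ∀ t < M, ∀ T ⊆ Finset.range t, 0 ∈ T → w (insert t T) ≤ f (t - T.sup id) * w T)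
    (hF : ∑ g ∈ Finset.Ico 1 M, f g ≤ F) (hF1 : F < 1) :
    ∑ T ∈ (Finset.range M).powerset, (if 0 ∈ T then w T else 0) ≤ w {0} / (1 - F) := by
  have key : ∀ N, 1 ≤ N → N ≤ M → ∑ T ∈ (Finset.range N).powerset,
      (if 0 ∈ T then w T * (1 - ∑ g ∈ Finset.Ico 1 (N - T.sup id), f g) else 0) ≤ w {0} := by
    intro N hN
    induction N, hN using Nat.le_induction with
    | base =>
      intro _
      have : (Finset.range 1).powerset = {∅, {0}} := by decide
      rw [this]
      simp
    | succ N hN ih =>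
      intro hNM
      refine le_trans ?_ (ih (by omega))
      rw [Finset.range_add_one, Finset.sum_powerset_insert (by simp), ← Finset.sum_add_distrib]
      refine Finset.sum_le_sum fun T hT => ?_
      rw [Finset.mem_powerset] at hT
      have h0 : 0 ∈ insert N T ↔ 0 ∈ T := by
        rw [Finset.mem_insert]; exact or_iff_right (by omega)
      simp only [h0]
      split_ifs with hT0
      · have hsup : T.sup id < N := by
          rw [Finset.sup_lt_iff (by simpa [Nat.pos_iff_ne_zero, Nat.one_le_iff_ne_zero] using hN)]
          exact fun b hb => Finset.mem_range.mp (hT hb)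
        have hsup2 : (insert N T).sup id = N := by
          rw [Finset.sup_insert]
          exact max_eq_left hsup.le
        rw [hsup2, show N + 1 - N = 1 by omega, Finset.Ico_self, Finset.sum_empty,
          show N + 1 - T.sup id = (N - T.sup id) + 1 by omega,
          Finset.sum_Ico_succ_top (by omega)]
        have := hstep N (by omega) T hT hT0
        linarith
      · simp
  have h1 := key M hM le_rfl
  rw [le_div_iff₀ (by linarith), Finset.sum_mul]
  refine le_trans (Finset.sum_le_sum fun T hT => ?_) h1
  split_ifs
  · refine mul_le_mul_of_nonneg_left ?_ (hw T)
    have : ∑ g ∈ Finset.Ico 1 (M - T.sup id), f g ≤ ∑ g ∈ Finset.Ico 1 M, f g :=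
      Finset.sum_le_sum_of_subset_of_nonneg (Finset.Ico_subset_Ico_right (by omega))
        fun g _ _ => hf g
    linarith
  · simp

/-! ### Permutations carrying prescribed arcs to arcs -/

/-- The union of the intervals of length `k` starting at the multiples `d t`, `t ∈ T`. -/
def coveredPositions (k d : ℕ) (T : Finset ℕ) : Finset ℕ :=
  T.biUnion fun t => Finset.Ico (d * t) (d * t + k)

lemma coveredPositions_insert (k d t : ℕ) (T : Finset ℕ) :
    coveredPositions k d (insert t T) =
      Finset.Ico (d * t) (d * t + k) ∪ coveredPositions k d T :=
  Finset.biUnion_insert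

lemma Ico_sdiff_coveredPositions {k d s t : ℕ} {T : Finset ℕ} (hs : s ∈ T) (hT : ∀ x ∈ T, x ≤ s)
    (hst : s < t) :
    Finset.Ico (d * t) (d * t + k) \ coveredPositions k d T =
      Finset.Ico (max (d * t) (d * s + k)) (d * t + k) := by
  ext j
  simp only [coveredPositions, Finset.mem_sdiff, Finset.mem_Ico, Finset.mem_biUnion, not_exists,
    not_and, not_lt, max_le_iff]
  constructor
  · rintro ⟨⟨h1, h2⟩, h3⟩
    have : d * s ≤ d * t := Nat.mul_le_mul_left _ hst.le
    exact ⟨⟨h1, h3 s hs (by omega)⟩, h2⟩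
  · rintro ⟨⟨h1, h3⟩, h2⟩
    refine ⟨⟨h1, h2⟩, fun x hx _ => ?_⟩
    have : d * x ≤ d * s := Nat.mul_le_mul_left _ (hT x hx)
    omega

lemma card_Ico_sdiff_coveredPositions {k d s t : ℕ} {T : Finset ℕ} (hs : s ∈ T)
    (hT : ∀ x ∈ T, x ≤ s) (hst : s < t) :
    (Finset.Ico (d * t) (d * t + k) \ coveredPositions k d T).card = min (d * (t - s)) k := by
  rw [Ico_sdiff_coveredPositions hs hT hst, Nat.card_Ico]
  have : d * (t - s) + d * s = d * t := by rw [← mul_add]; congr 1; omega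
  omega

lemma card_coveredPositions_insert {k d s t : ℕ} {T : Finset ℕ} (hs : s ∈ T)
    (hT : ∀ x ∈ T, x ≤ s) (hst : s < t) :
    (coveredPositions k d (insert t T)).card =
      (coveredPositions k d T).card + min (d * (t - s)) k := by
  rw [← card_Ico_sdiff_coveredPositions hs hT hst, coveredPositions_insert,
    ← Finset.card_sdiff_add_card, add_comm]

/-- The permutations that map each interval of length `k` starting at `d t`, `t ∈ T`, onto a member
of `𝒜`, positions being labelled by `ι`. -/
def arcPreserving {β : Type*} [Fintype β] [DecidableEq β] (k d : ℕ) (𝒜 : Finset (Finset β)) (ι : ℕ → β) (T : Finset ℕ) :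
    Finset (Equiv.Perm β) :=
  Finset.univ.filter fun π => ∀ t ∈ T, (Finset.Ico (d * t) (d * t + k)).image (fun j => π (ι j)) ∈ 𝒜

/-- The restriction of a permutation to a set of positions. -/
def restrictTo {β : Type*} (ι : ℕ → β) (U : Finset ℕ) (π : Equiv.Perm β) : ℕ → Option β :=
  fun j => if j ∈ U then some (π (ι j)) else none

open Classical in
/-- The number of partial injections on the covered positions that preserve the arcs. -/
noncomputable def numRestrictions {β : Type*} [Fintype β] [DecidableEq β] (k d : ℕ)
    (𝒜 : Finset (Finset β)) (ι : ℕ → β) (T : Finset ℕ) : ℕ :=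
  ((arcPreserving k d 𝒜 ι T).image (restrictTo ι (coveredPositions k d T))).card

lemma mem_arcPreserving {β : Type*} [Fintype β] [DecidableEq β] {k d : ℕ}
    {𝒜 : Finset (Finset β)} {ι : ℕ → β} {T : Finset ℕ}
    {π : Equiv.Perm β} : π ∈ arcPreserving k d 𝒜 ι T ↔
      ∀ t ∈ T, (Finset.Ico (d * t) (d * t + k)).image (fun j => π (ι j)) ∈ 𝒜 := by
  simp [arcPreserving]

lemma restrictTo_eq_iff {β : Type*} {ι : ℕ → β} {U : Finset ℕ} {π π' : Equiv.Perm β} :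
    restrictTo ι U π = restrictTo ι U π' ↔ ∀ j ∈ U, π (ι j) = π' (ι j) := by
  constructor
  · intro h j hj
    have := congrFun h j
    simpa [restrictTo, hj] using this
  · intro h
    funext j
    by_cases hj : j ∈ U
    · simp [restrictTo, hj, h j hj]
    · simp [restrictTo, hj]

/-- Each value of g comes from an injection of V into B, and no injection yields two values. -/
lemma card_image_le_factorial {β γ : Type*} [DecidableEq γ] {ι : ℕ → β} {S : Finset (Equiv.Perm β)}
    {g : Equiv.Perm β → γ} {V : Finset ℕ} {B : Finset β} (hι : Set.InjOn ι V)
    (hB : B.card ≤ V.card) (hVB : ∀ π ∈ S, ∀ j ∈ V, π (ι j) ∈ B)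
    (hg : ∀ π ∈ S, ∀ π' ∈ S, (∀ j ∈ V, π (ι j) = π' (ι j)) → g π = g π') :
    (S.image g).card ≤ V.card.factorial := by
  have h1 : (S.image g).card ≤ (Finset.univ : Finset (V ↪ B)).card := by
    refine Finset.card_le_card_of_forall_subsingleton
      (fun a e => ∃ π ∈ S, g π = a ∧ ∀ j : V, (e j : β) = π (ι j)) ?_ ?_
    · intro a ha
      obtain ⟨π, hπ, rfl⟩ := Finset.mem_image.mp ha
      refine ⟨⟨fun j => ⟨π (ι j), hVB π hπ j j.2⟩, fun i j hij => ?_⟩, Finset.mem_univ _, π, hπ,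
        rfl, fun j => rfl⟩
      have := Subtype.ext_iff.mp hij
      exact Subtype.ext (hι i.2 j.2 (π.injective this))
    · rintro e _ a ⟨_, π, hπ, rfl, h⟩ a' ⟨_, π', hπ', rfl, h'⟩
      exact hg π hπ π' hπ' fun j hj => (h ⟨j, hj⟩).symm.trans (h' ⟨j, hj⟩)
  refine h1.trans ?_
  rw [Finset.card_univ, Fintype.card_embedding_eq, Fintype.card_coe, Fintype.card_coe]
  exact (Nat.descFactorial_le _ hB).trans (Nat.descFactorial_self _).le

-- Once the values on the covered positions are fixed, the remaining positions are matched
-- injectively with the remaining points.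
open Classical in
lemma card_arcPreserving_le {β : Type*} [Fintype β] [DecidableEq β] 
    {k d n : ℕ} {𝒜 : Finset (Finset β)} {ι : ℕ → β} {T : Finset ℕ}
    (hn : Fintype.card β = n) (hι : Set.InjOn ι (Finset.range n : Finset ℕ))
    (hT : coveredPositions k d T ⊆ Finset.range n) :
    (arcPreserving k d 𝒜 ι T).card ≤
      (n - (coveredPositions k d T).card).factorial * numRestrictions k d 𝒜 ι T := by
  refine Finset.card_le_mul_card_image _ _ fun a ha => ?_
  obtain ⟨π₀, hπ₀, rfl⟩ := Finset.mem_image.mp ha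
  set U := coveredPositions k d T
  have hV : (Finset.range n \ U).card = n - U.card := by
    rw [Finset.card_sdiff_of_subset hT, Finset.card_range]
  have hsurj : (Finset.range n).image ι = Finset.univ := by
    rw [← Finset.card_eq_iff_eq_univ, Finset.card_image_of_injOn hι, Finset.card_range, hn]
  rw [← hV, ← Finset.image_id (s := Finset.filter _ _)]
  refine card_image_le_factorial (ι := ι) (V := Finset.range n \ U)
    (B := Finset.univ \ U.image fun j => π₀ (ι j))
    (hι.mono (by exact_mod_cast Finset.sdiff_subset)) ?_ ?_ ?_
  · rw [Finset.card_sdiff_of_subset (Finset.subset_univ _), hV, Finset.card_univ, hn,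
      Finset.card_image_of_injOn]
    exact fun i hi j hj h => hι (hT hi) (hT hj) (π₀.injective h)
  · intro π hπ j hj
    have hπ := restrictTo_eq_iff.mp (Finset.mem_filter.mp hπ).2
    rw [Finset.mem_sdiff] at hj ⊢
    refine ⟨Finset.mem_univ _, fun h => hj.2 ?_⟩
    obtain ⟨i, hi, hij⟩ := Finset.mem_image.mp h
    rw [← hπ i hi] at hij
    exact hι (hT hi) hj.1 (π.injective hij) ▸ hi
  · intro π hπ π' hπ' h
    have hπ := restrictTo_eq_iff.mp (Finset.mem_filter.mp hπ).2
    have hπ' := restrictTo_eq_iff.mp (Finset.mem_filter.mp hπ').2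
    refine Equiv.ext fun x => ?_
    obtain ⟨j, hj, rfl⟩ := Finset.mem_image.mp (hsurj.symm ▸ Finset.mem_univ x)
    by_cases hjU : j ∈ U
    · exact (hπ j hjU).trans (hπ' j hjU).symm
    · exact h j (Finset.mem_sdiff.mpr ⟨hj, hjU⟩)

-- Over a fixed restriction to the old positions U, an extension to the new interval I is determined
-- by the image arc of I, for which there are at most q choices, and by the order in which I \ U
-- fills the rest of that arc.
open Classical in
lemma numRestrictions_insert_le {β : Type*} [Fintype β] [DecidableEq β] 
    {k d n t q : ℕ} {𝒜 : Finset (Finset β)} {ι : ℕ → β} {T : Finset ℕ}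
    (hι : Set.InjOn ι (Finset.range n : Finset ℕ)) (ht : d * t + k ≤ n)
    (hq : ∀ π₀ ∈ arcPreserving k d 𝒜 ι T, (𝒜.filter fun B => ∃ π ∈ arcPreserving k d 𝒜 ι (insert t T),
      (∀ j ∈ coveredPositions k d T, π (ι j) = π₀ (ι j)) ∧
      (Finset.Ico (d * t) (d * t + k)).image (fun j => π (ι j)) = B).card ≤ q) :
    numRestrictions k d 𝒜 ι (insert t T) ≤
      q * (Finset.Ico (d * t) (d * t + k) \ coveredPositions k d T).card.factorial *
        numRestrictions k d 𝒜 ι T := by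
  set U := coveredPositions k d T with hU
  set I := Finset.Ico (d * t) (d * t + k) with hI
  have hIn : I ⊆ Finset.range n := fun j hj => by
    rw [hI, Finset.mem_Ico] at hj
    exact Finset.mem_range.mpr (by omega)
  have hUT : coveredPositions k d (insert t T) = I ∪ U := coveredPositions_insert k d t T
  let proj : (ℕ → Option β) → (ℕ → Option β) := fun f j => if j ∈ U then f j else none
  have hproj : ∀ π, proj (restrictTo ι (I ∪ U) π) = restrictTo ι U π := by
    intro π
    funext j
    by_cases hj : j ∈ U <;> simp [proj, restrictTo, hj]
  have hsub : ∀ π ∈ arcPreserving k d 𝒜 ι (insert t T), π ∈ arcPreserving k d 𝒜 ι T := by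
    intro π hπ
    rw [mem_arcPreserving] at hπ ⊢
    exact fun s hs => hπ s (Finset.mem_insert_of_mem hs)
  have himage : (((arcPreserving k d 𝒜 ι (insert t T)).image (restrictTo ι (I ∪ U))).image proj).card
      ≤ numRestrictions k d 𝒜 ι T := by
    refine Finset.card_le_card fun a ha => ?_
    obtain ⟨b, hb, rfl⟩ := Finset.mem_image.mp ha
    obtain ⟨π, hπ, rfl⟩ := Finset.mem_image.mp hb
    rw [hproj]
    exact Finset.mem_image_of_mem _ (hsub π hπ)
  rw [numRestrictions, hUT]
  refine (Finset.card_le_mul_card_image (f := proj) _ (q * (I \ U).card.factorial) ?_).trans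
    (Nat.mul_le_mul_left _ himage)
  intro a ha
  obtain ⟨b, hb, rfl⟩ := Finset.mem_image.mp ha
  obtain ⟨π₀, hπ₀, rfl⟩ := Finset.mem_image.mp hb
  rw [hproj]
  let S : Finset β → Finset (Equiv.Perm β) := fun B =>
    (arcPreserving k d 𝒜 ι (insert t T)).filter fun π =>
      (∀ j ∈ U, π (ι j) = π₀ (ι j)) ∧ I.image (fun j => π (ι j)) = B
  set J := 𝒜.filter fun B => ∃ π ∈ arcPreserving k d 𝒜 ι (insert t T),
      (∀ j ∈ U, π (ι j) = π₀ (ι j)) ∧ I.image (fun j => π (ι j)) = B with hJ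
  have hfib : (((arcPreserving k d 𝒜 ι (insert t T)).image (restrictTo ι (I ∪ U))).filter
      fun x => proj x = restrictTo ι U π₀) ⊆ J.biUnion fun B => (S B).image (restrictTo ι (I ∪ U)) := by
    intro x hx
    obtain ⟨hx1, hx2⟩ := Finset.mem_filter.mp hx
    obtain ⟨π, hπ, rfl⟩ := Finset.mem_image.mp hx1
    rw [hproj, restrictTo_eq_iff] at hx2
    refine Finset.mem_biUnion.mpr ⟨I.image (fun j => π (ι j)), ?_, ?_⟩
    · exact Finset.mem_filter.mpr ⟨mem_arcPreserving.mp hπ t (Finset.mem_insert_self _ _),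
        π, hπ, hx2, rfl⟩
    · exact Finset.mem_image_of_mem _ (Finset.mem_filter.mpr ⟨hπ, hx2, rfl⟩)
  refine (Finset.card_le_card hfib).trans ((Finset.card_biUnion_le_card_mul _ _ _ ?_).trans
    (Nat.mul_le_mul_right _ (hq π₀ (hsub π₀ hπ₀))))
  intro B hB
  obtain ⟨-, π₁, -, hπ₁U, hπ₁B⟩ := Finset.mem_filter.mp hB
  -- The new positions must land in B outside the points already taken by I ∩ U; `π₁` witnesses that
  -- at most |I \ U| such points are left.
  refine card_image_le_factorial (ι := ι) (V := I \ U)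
    (B := B \ (I ∩ U).image fun j => π₀ (ι j)) (hι.mono ?_) ?_ ?_ ?_
  · exact_mod_cast Finset.sdiff_subset.trans hIn
  · refine (Finset.card_le_card (t := (I \ U).image fun j => π₁ (ι j)) ?_).trans
      Finset.card_image_le
    intro x hx
    rw [Finset.mem_sdiff, ← hπ₁B] at hx
    obtain ⟨j, hj, rfl⟩ := Finset.mem_image.mp hx.1
    refine Finset.mem_image.mpr ⟨j, Finset.mem_sdiff.mpr ⟨hj, fun hjU => hx.2 ?_⟩, rfl⟩
    exact Finset.mem_image.mpr ⟨j, Finset.mem_inter.mpr ⟨hj, hjU⟩, (hπ₁U j hjU).symm⟩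
  · intro π hπ j hj
    obtain ⟨-, h1, h2⟩ := Finset.mem_filter.mp hπ
    obtain ⟨hj1, hj2⟩ := Finset.mem_sdiff.mp hj
    rw [Finset.mem_sdiff]
    refine ⟨h2 ▸ Finset.mem_image_of_mem _ hj1, fun h => ?_⟩
    obtain ⟨i, hi, hij⟩ := Finset.mem_image.mp h
    obtain ⟨hi1, hi2⟩ := Finset.mem_inter.mp hi
    rw [← h1 i hi2] at hij
    exact hj2 (hι (hIn hi1) (hIn hj1) (π.injective hij) ▸ hi2)
  · intro π hπ π' hπ' h
    obtain ⟨-, h1, -⟩ := Finset.mem_filter.mp hπ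
    obtain ⟨-, h1', -⟩ := Finset.mem_filter.mp hπ'
    rw [restrictTo_eq_iff]
    intro j hj
    by_cases hjU : j ∈ U
    · exact (h1 j hjU).trans (h1' j hjU).symm
    · exact h j (Finset.mem_sdiff.mpr ⟨(Finset.mem_union.mp hj).resolve_right hjU, hjU⟩)

/-- A bound for the number of ways to extend a partial injection preserving arcs to an arc that
starts `d g` positions later; `A` is the bound for `g = 1`. -/
noncomputable def extensionBound (A : ℝ) (k d m g : ℕ) : ℝ :=
  if g = 1 then A else if d * g < k then k * k.factorial else m * k.factorial

/-- The factor by which the weight of a set of arcs grows with a further arc, `d g` positions after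
the last one. -/
noncomputable def stepWeight (Y A : ℝ) (k d m n g : ℕ) : ℝ :=
  Y * extensionBound A k d m g * (Real.exp 1 / n) ^ min (d * g) k

/-- A bound for the number of ways to extend across one step: either the general bound, or `1` for
families of sets of consecutive points starting at arbitrary positions. -/
def IsStepBound {β : Type*} [DecidableEq β] (A : ℝ) (k d : ℕ) (𝒜 : Finset (Finset β)) : Prop :=
  A = k * k.factorial ∨ (A = 1 ∧ d = 1 ∧
    ∀ B₀ ∈ 𝒜, ∀ S ⊆ B₀, S.card = k - 1 → (𝒜.filter fun B => S ⊆ B ∧ B ≠ B₀).card ≤ 1)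

lemma IsStepBound.one_le {β : Type*} [DecidableEq β] {A : ℝ} {k d : ℕ} {𝒜 : Finset (Finset β)}
    (h : IsStepBound A k d 𝒜) (hk : 1 ≤ k) : 1 ≤ A := by
  rcases h with rfl | ⟨rfl, -⟩
  · exact_mod_cast Nat.mul_pos hk (Nat.factorial_pos k)
  · exact le_rfl

/-- If the new interval meets the last one, its first position is already mapped, so its image is
one of at most k arcs through a known point. Otherwise any of the m arcs may occur. For d = 1 and
adjacent intervals, k - 1 points of the image are known, the arc is unique, and only one position is
new. -/
lemma numRestrictions_insert_le_extensionBound {β : Type*} [Fintype β] [DecidableEq β]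
    {k d m n t : ℕ} {A : ℝ} {𝒜 : Finset (Finset β)} {ι : ℕ → β} {T : Finset ℕ}
    (hι : Set.InjOn ι (Finset.range n : Finset ℕ)) (hd : 1 ≤ d) (hdk : d < k)
    (ht : d * t + k ≤ n) (h𝒜 : 𝒜.card ≤ m)
    (hdeg : ∀ z, (𝒜.filter fun B => z ∈ B).card ≤ k) (hA : IsStepBound A k d 𝒜)
    (hT : T ⊆ Finset.range t) (hT0 : T.Nonempty) :
    (numRestrictions k d 𝒜 ι (insert t T) : ℝ) ≤
      extensionBound A k d m (t - T.sup id) * numRestrictions k d 𝒜 ι T := by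
  classical
  obtain ⟨s, hs, hsup⟩ := Finset.exists_mem_eq_sup T hT0 id
  have hle : ∀ x ∈ T, x ≤ s := fun x hx => by
    have : id x ≤ T.sup id := Finset.le_sup hx
    rw [hsup] at this
    exact this
  have hst : s < t := Finset.mem_range.mp (hT hs)
  simp only [id] at hsup
  rw [hsup]
  have hmem : ∀ j, d * s ≤ j → j < d * s + k → j ∈ coveredPositions k d T := fun j h1 h2 =>
    Finset.mem_biUnion.mpr ⟨s, hs, Finset.mem_Ico.mpr ⟨h1, h2⟩⟩
  have hv := card_Ico_sdiff_coveredPositions (k := k) (d := d) hs hle hst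
  have hvk : (min (d * (t - s)) k).factorial ≤ k.factorial := Nat.factorial_le (min_le_right _ _)
  have hdts : d * (t - s) + d * s = d * t := by rw [← mul_add]; congr 1; omega
  have overlap : d * (t - s) < k → (numRestrictions k d 𝒜 ι (insert t T) : ℝ) ≤
      (k * k.factorial) * numRestrictions k d 𝒜 ι T := by
    intro hg
    have h := numRestrictions_insert_le (q := k) hι ht (T := T) (𝒜 := 𝒜) fun π₀ hπ₀ => by
      refine (Finset.card_le_card fun B hB => ?_).trans (hdeg (π₀ (ι (d * t))))
      obtain ⟨h1, π, -, h2, h3⟩ := Finset.mem_filter.mp hB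
      refine Finset.mem_filter.mpr ⟨h1, ?_⟩
      rw [← h3, ← h2 (d * t) (hmem _ (by omega) (by omega))]
      exact Finset.mem_image_of_mem _ (Finset.mem_Ico.mpr ⟨le_rfl, by omega⟩)
    rw [hv] at h
    have h' := h.trans (Nat.mul_le_mul_right _ (Nat.mul_le_mul_left k hvk))
    exact_mod_cast h'
  unfold extensionBound
  split_ifs with h1 h2
  · rcases hA with rfl | ⟨rfl, rfl, htight⟩
    · exact overlap (by rw [h1]; omega)
    · have h := numRestrictions_insert_le (q := 1) hι ht (T := T) (𝒜 := 𝒜) fun π₀ hπ₀ => by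
        have hB₀ := mem_arcPreserving.mp hπ₀ s hs
        refine (Finset.card_le_card fun B hB => ?_).trans (htight _ hB₀
          ((Finset.Ico t (s + k)).image fun j => π₀ (ι j)) ?_ ?_)
        · obtain ⟨h1', π, -, h2, h3⟩ := Finset.mem_filter.mp hB
          refine Finset.mem_filter.mpr ⟨h1', ?_, ?_⟩
          · intro x hx
            obtain ⟨j, hj, rfl⟩ := Finset.mem_image.mp hx
            rw [Finset.mem_Ico] at hj
            rw [← h3, ← h2 j (hmem _ (by omega) (by omega))]
            exact Finset.mem_image_of_mem _ (Finset.mem_Ico.mpr ⟨by omega, by omega⟩)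
          -- The image differs from the previous arc, since the k points of that arc are already
          -- taken by the positions s, ..., s + k - 1 and the last position t + k - 1 is new.
          · rintro rfl
            have hx : π (ι (1 * t + k - 1)) ∈
                (Finset.Ico (1 * t) (1 * t + k)).image fun j => π (ι j) :=
              Finset.mem_image_of_mem _ (Finset.mem_Ico.mpr ⟨by omega, by omega⟩)
            rw [h3] at hx
            obtain ⟨j, hj, hjx⟩ := Finset.mem_image.mp hx
            rw [Finset.mem_Ico] at hj
            rw [← h2 j (hmem _ (by omega) (by omega))] at hjx
            have := hι (Finset.mem_coe.mpr (Finset.mem_range.mpr (by omega)))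
              (Finset.mem_coe.mpr (Finset.mem_range.mpr (by omega))) (π.injective hjx)
            omega
        · exact Finset.image_subset_image fun j hj => by
            rw [Finset.mem_Ico] at hj ⊢
            omega
        · rw [Finset.card_image_of_injOn, Nat.card_Ico]
          · omega
          · intro i hi j hj hij
            rw [Finset.coe_Ico, Set.mem_Ico] at hi hj
            exact hι (Finset.mem_coe.mpr (Finset.mem_range.mpr (by omega)))
              (Finset.mem_coe.mpr (Finset.mem_range.mpr (by omega))) (π₀.injective hij)
      rw [hv, h1, min_eq_left (by omega)] at h
      simpa using h
  · exact overlap h2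
  · have h := numRestrictions_insert_le (q := m) hι ht (T := T) (𝒜 := 𝒜) fun π₀ hπ₀ =>
      (Finset.card_filter_le _ _).trans h𝒜
    rw [hv] at h
    have h' := h.trans (Nat.mul_le_mul_right _ (Nat.mul_le_mul_left m hvk))
    exact_mod_cast h'

lemma numRestrictions_singleton_le {β : Type*} [Fintype β] [DecidableEq β]
    {k d m n : ℕ} {𝒜 : Finset (Finset β)} {ι : ℕ → β}
    (hι : Set.InjOn ι (Finset.range n : Finset ℕ)) (hk : k ≤ n) (h𝒜 : 𝒜.card ≤ m) :
    numRestrictions k d 𝒜 ι {0} ≤ m * k.factorial := by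
  classical
  have h := numRestrictions_insert_le (k := k) (d := d) (t := 0) (q := m) hι (by omega) (T := ∅)
    (𝒜 := 𝒜) fun π₀ hπ₀ => (Finset.card_filter_le _ _).trans h𝒜
  have h1 : numRestrictions k d 𝒜 ι ∅ ≤ 1 := by
    refine Finset.card_le_one.mpr fun a ha b hb => ?_
    obtain ⟨π, -, rfl⟩ := Finset.mem_image.mp ha
    obtain ⟨π', -, rfl⟩ := Finset.mem_image.mp hb
    rw [restrictTo_eq_iff]
    simp [coveredPositions]
  have h2 : (Finset.Ico (d * 0) (d * 0 + k) \ coveredPositions k d ∅).card = k := by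
    simp [coveredPositions]
  rw [h2] at h
  calc _ ≤ m * k.factorial * numRestrictions k d 𝒜 ι ∅ := h
    _ ≤ m * k.factorial * 1 := Nat.mul_le_mul_left _ h1
    _ = _ := mul_one _

/-- The weighted count of pairs of a permutation and a set of arcs, among those preserved, that
contains the first arc and leaves a gap before it. -/
lemma sum_arcPreserving_le {β : Type*} [Fintype β] [DecidableEq β]
    {k d m n : ℕ} {Y A F : ℝ} {𝒜 : Finset (Finset β)} {ι : ℕ → β}
    (hn : Fintype.card β = n) (hι : Set.InjOn ι (Finset.range n : Finset ℕ))
    (hnm : n = d * m) (hd : 1 ≤ d) (hdk : d < k) (hkm : k ≤ m) (h𝒜 : 𝒜.card ≤ m)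
    (hdeg : ∀ z, (𝒜.filter fun B => z ∈ B).card ≤ k) (hA : IsStepBound A k d 𝒜) (hY : 0 ≤ Y)
    (hF : ∑ g ∈ Finset.Ico 1 (m - k + 1), stepWeight Y A k d m n g ≤ F) (hF1 : F < 1) :
    ∑ T ∈ (Finset.range (m - k + 1)).powerset,
      (if 0 ∈ T then Y ^ T.card * ((arcPreserving k d 𝒜 ι T).card : ℝ) else 0) ≤
      n.factorial * (Y * (m * k.factorial) * (Real.exp 1 / n) ^ k / (1 - F)) := by
  have hn0 : 0 < n := by rw [hnm]; exact Nat.mul_pos hd (by omega)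
  have hA0 : 0 ≤ A := le_trans zero_le_one (hA.one_le (by omega))
  have hbound : ∀ t, t < m - k + 1 → d * t + k ≤ n := by
    intro t ht
    have h1 : d * t ≤ d * (m - k) := Nat.mul_le_mul_left _ (by omega)
    have h2 : d * (m - k) + d * k = d * m := by rw [← mul_add]; congr 1; omega
    have h3 : 1 * k ≤ d * k := Nat.mul_le_mul_right _ hd
    omega
  -- The factor (e/n)^|U| stands for (n - |U|)!/n!, by `factorial_sub_le`; unlike the factorial
  -- quotient it is multiplicative when an arc is added.
  set w : Finset ℕ → ℝ := fun T => Y ^ T.card * numRestrictions k d 𝒜 ι T *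
    (Real.exp 1 / n) ^ (coveredPositions k d T).card with hw
  have hren : ∑ T ∈ (Finset.range (m - k + 1)).powerset, (if 0 ∈ T then w T else 0) ≤
      w {0} / (1 - F) := by
    refine sum_powerset_le_of_renewal (f := stepWeight Y A k d m n) (by omega)
      (fun T => by positivity) (fun g => ?_) ?_ hF hF1
    · unfold stepWeight extensionBound
      split_ifs <;> positivity
    · intro t ht T hT h0
      have h1 := numRestrictions_insert_le_extensionBound hι hd hdk (hbound t ht) h𝒜 hdeg hA hT
        ⟨0, h0⟩
      obtain ⟨s, hs, hsup⟩ := Finset.exists_mem_eq_sup T ⟨0, h0⟩ id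
      have hle : ∀ x ∈ T, x ≤ T.sup id := fun x hx => by
        have : id x ≤ T.sup id := Finset.le_sup hx
        exact this
      have hsT : T.sup id ∈ T := by rw [hsup]; exact hs
      have h2 := card_coveredPositions_insert (k := k) (d := d) hsT hle
        (Finset.mem_range.mp (hT hsT))
      have h3 : (insert t T).card = T.card + 1 := Finset.card_insert_of_notMem fun h =>
        (Finset.mem_range.mp (hT h)).false
      simp only [hw, h2, h3, stepWeight, pow_add, pow_one]
      calc Y ^ T.card * Y * (numRestrictions k d 𝒜 ι (insert t T) : ℝ) *
            ((Real.exp 1 / n) ^ (coveredPositions k d T).card *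
              (Real.exp 1 / n) ^ min (d * (t - T.sup id)) k)
          ≤ Y ^ T.card * Y * (extensionBound A k d m (t - T.sup id) *
              numRestrictions k d 𝒜 ι T) *
            ((Real.exp 1 / n) ^ (coveredPositions k d T).card *
              (Real.exp 1 / n) ^ min (d * (t - T.sup id)) k) := by gcongr
        _ = _ := by ring
  have hw0 : w {0} ≤ Y * (m * k.factorial) * (Real.exp 1 / n) ^ k := by
    have h1 : (numRestrictions k d 𝒜 ι {0} : ℝ) ≤ m * k.factorial := by
      exact_mod_cast numRestrictions_singleton_le hι (by simpa using hbound 0 (by omega)) h𝒜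
    have h2 : (coveredPositions k d {0}).card = k := by simp [coveredPositions]
    simp only [hw, h2, Finset.card_singleton, pow_one]
    gcongr
  calc _ ≤ ∑ T ∈ (Finset.range (m - k + 1)).powerset,
        (n.factorial : ℝ) * (if 0 ∈ T then w T else 0) := by
        refine Finset.sum_le_sum fun T hT => ?_
        rw [Finset.mem_powerset] at hT
        split_ifs with h0
        · have hU : coveredPositions k d T ⊆ Finset.range n := by
            intro j hj
            obtain ⟨t, ht, hj⟩ := Finset.mem_biUnion.mp hj
            have := hbound t (Finset.mem_range.mp (hT ht))
            rw [Finset.mem_Ico] at hj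
            exact Finset.mem_range.mpr (by omega)
          have hUn : (coveredPositions k d T).card ≤ n := by
            simpa using Finset.card_le_card hU
          have h1 : ((arcPreserving k d 𝒜 ι T).card : ℝ) ≤
              (n - (coveredPositions k d T).card).factorial * numRestrictions k d 𝒜 ι T := by
            exact_mod_cast card_arcPreserving_le hn hι hU
          have h2 := factorial_sub_le hUn hn0
          simp only [hw]
          calc _ ≤ Y ^ T.card * (((n - (coveredPositions k d T).card).factorial : ℝ) *
                numRestrictions k d 𝒜 ι T) := by gcongr
            _ ≤ Y ^ T.card * (((Real.exp 1 / n) ^ (coveredPositions k d T).card * n.factorial) *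
                numRestrictions k d 𝒜 ι T) := by gcongr
            _ = _ := by ring
        · simp
    _ = (n.factorial : ℝ) * ∑ T ∈ (Finset.range (m - k + 1)).powerset,
        (if 0 ∈ T then w T else 0) := by rw [Finset.mul_sum]
    _ ≤ (n.factorial : ℝ) * (w {0} / (1 - F)) := by gcongr
    _ ≤ _ := by
      have : 0 ≤ 1 - F := by linarith
      gcongr

/-! ### Periodic predicates on `ℕ` -/

lemma periodic_add_iff {D : ℕ → Prop} {m : ℕ} (hD : ∀ i, D (i + m) ↔ D i) (i q : ℕ) :
    D (i + m * q) ↔ D i := by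
  induction q with
  | zero => simp
  | succ q ih => rw [Nat.mul_succ, ← add_assoc, hD, ih]

lemma count_shift_of_periodic {D : ℕ → Prop} [DecidablePred D] {m : ℕ}
    (hD : ∀ i, D (i + m) ↔ D i) (i : ℕ) : Nat.count (fun t => D (i + t)) m = Nat.count D m := by
  have h1 := Nat.count_add D i m
  have h2 := Nat.count_add D m i
  have h3 : Nat.count (fun t => D (m + t)) i = Nat.count D i := by
    simp only [Nat.count_eq_card_filter_range]
    congr 1
    exact Finset.filter_congr fun t _ => by rw [add_comm, hD]
  rw [add_comm m i, h1, h3] at h2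
  omega

/-- The range contains m / k disjoint windows of length k, and each one is hit. -/
lemma div_le_count_of_windows {D : ℕ → Prop} [DecidablePred D] {k m : ℕ}
    (hw : ∀ x, ∃ j < k, D (x + j)) : m / k ≤ Nat.count D m := by
  have h : ∀ j, j ≤ Nat.count D (k * j) := by
    intro j
    induction j with
    | zero => simp
    | succ j ih =>
      rw [Nat.mul_succ, Nat.count_add]
      have : 0 < Nat.count (fun t => D (k * j + t)) k := by
        rw [Nat.count_eq_card_filter_range, Finset.card_pos]
        obtain ⟨i, hi, hDi⟩ := hw (k * j)
        exact ⟨i, by simpa using ⟨hi, hDi⟩⟩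
      omega
  exact (h _).trans (Nat.count_monotone D (Nat.mul_div_le m k))

-- Let I be the trace of D on one period. If some i in I has no member of D among the k - 1 places
-- cyclically before it, then I shifted by i is one of the sets T and contributes y^|I|. Otherwise
-- every window of length k is hit, so |I| ≥ m/k; dropping the last k - 1 places leaves T with |T| ≥
-- |I| - k, and L^|T| ≥ L^(m/k - k) pays for the small coefficient. The 1 covers empty I.
-- Restricting T to [0, m - k] keeps the arcs from wrapping round.
open Classical in
lemma pow_card_le_sum_powerset {D : ℕ → Prop} {m k : ℕ} (hD : ∀ i, D (i + m) ↔ D i)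
    {y L : ℝ} (hy : 1 ≤ y) (hL : 1 ≤ L) (hk : 1 ≤ k) (hkm : k ≤ m) :
    y ^ ((Finset.range m).filter D).card ≤
      1 + ∑ i ∈ Finset.range m, ∑ T ∈ (Finset.range (m - k + 1)).powerset,
        if 0 ∈ T ∧ ∀ t ∈ T, D (i + t) then
          y ^ T.card + y ^ k / L ^ (m / k - k) * (L * y) ^ T.card else 0 := by
  have hterm : ∀ (i : ℕ) (T : Finset ℕ), 0 ≤ if 0 ∈ T ∧ ∀ t ∈ T, D (i + t) then
      y ^ T.card + y ^ k / L ^ (m / k - k) * (L * y) ^ T.card else 0 := by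
    intro i T
    split_ifs <;> positivity
  have single : ∀ i < m, ∀ T ⊆ Finset.range (m - k + 1), 0 ∈ T → (∀ t ∈ T, D (i + t)) →
      y ^ T.card + y ^ k / L ^ (m / k - k) * (L * y) ^ T.card ≤
      ∑ i ∈ Finset.range m, ∑ T ∈ (Finset.range (m - k + 1)).powerset,
        if 0 ∈ T ∧ ∀ t ∈ T, D (i + t) then
          y ^ T.card + y ^ k / L ^ (m / k - k) * (L * y) ^ T.card else 0 := by
    intro i hi T hT h0 hDT
    refine le_trans ?_ (Finset.single_le_sum
      (f := fun i => ∑ T ∈ (Finset.range (m - k + 1)).powerset,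
        if 0 ∈ T ∧ ∀ t ∈ T, D (i + t) then
          y ^ T.card + y ^ k / L ^ (m / k - k) * (L * y) ^ T.card else 0)
      (fun i _ => Finset.sum_nonneg fun T _ => hterm i T) (Finset.mem_range.mpr hi))
    refine le_trans (le_of_eq ?_) (Finset.single_le_sum
      (f := fun T : Finset ℕ => if 0 ∈ T ∧ ∀ t ∈ T, D (i + t) then
          y ^ T.card + y ^ k / L ^ (m / k - k) * (L * y) ^ T.card else 0)
      (fun T _ => hterm i T) (Finset.mem_powerset.mpr hT))
    simp only [if_pos (And.intro h0 hDT)]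
  have hsum0 := Finset.sum_nonneg fun i (_ : i ∈ Finset.range m) =>
    Finset.sum_nonneg fun T (_ : T ∈ (Finset.range (m - k + 1)).powerset) => hterm i T
  rcases Finset.eq_empty_or_nonempty ((Finset.range m).filter D) with hI | ⟨i₀, hi₀⟩
  · rw [hI]
    simpa using hsum0
  have hcount : ∀ i, ((Finset.range m).filter fun t => D (i + t)).card =
      ((Finset.range m).filter D).card := by
    intro i
    rw [← Nat.count_eq_card_filter_range, ← Nat.count_eq_card_filter_range,
      count_shift_of_periodic hD]
  by_cases hA : ∃ i < m, D i ∧ ∀ t, m - k + 1 ≤ t → t < m → ¬ D (i + t)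
  · obtain ⟨i, hi, hDi, hgap⟩ := hA
    have h := single i hi ((Finset.range (m - k + 1)).filter fun t => D (i + t))
      (Finset.filter_subset _ _) (by simpa using hDi) (fun t ht => (Finset.mem_filter.mp ht).2)
    have hcard : ((Finset.range (m - k + 1)).filter fun t => D (i + t)).card =
        ((Finset.range m).filter D).card := by
      rw [← hcount i]
      congr 1
      ext t
      simp only [Finset.mem_filter, Finset.mem_range]
      refine ⟨fun h => ⟨by omega, h.2⟩, fun h => ⟨?_, h.2⟩⟩
      by_contra hlt
      exact hgap t (by omega) h.1 h.2
    rw [hcard] at h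
    have : 0 ≤ y ^ k / L ^ (m / k - k) * (L * y) ^ ((Finset.range m).filter D).card := by
      positivity
    linarith
  · push Not at hA
    have hback : ∀ z, D z → m ≤ z → ∃ s, 1 ≤ s ∧ s < k ∧ D (z - s) := by
      intro z hz hmz
      have hz' : z % m + m * (z / m) = z := Nat.mod_add_div z m
      obtain ⟨t, ht1, ht2, ht⟩ := hA (z % m) (Nat.mod_lt _ (by omega))
        ((periodic_add_iff hD _ (z / m)).mp (by rwa [hz']))
      refine ⟨m - t, by omega, by omega, ?_⟩
      rw [← hD, show z - (m - t) + m = z % m + t + m * (z / m) by omega, periodic_add_iff hD]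
      exact ht
    -- The least member z ≥ x + m of D lies below x + m + k, since otherwise `hback` gives a smaller
    -- one. The shift by m keeps the subtractions in ℕ honest.
    have hwin : ∀ x, ∃ j < k, D (x + j) := by
      intro x
      have hex : ∃ z, x + m ≤ z ∧ D z := by
        refine ⟨i₀ + m * (x + 1), ?_, (periodic_add_iff hD _ _).mpr (Finset.mem_filter.mp hi₀).2⟩
        have : x ≤ m * x := Nat.le_mul_of_pos_left x (by omega)
        rw [Nat.mul_succ]
        omega
      obtain ⟨hz1, hz2⟩ := Nat.find_spec hex
      have hmin := fun z => Nat.find_min hex (m := z)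
      set z := Nat.find hex
      by_cases hzk : z < x + m + k
      · refine ⟨z - m - x, by omega, ?_⟩
        rw [← hD, show x + (z - m - x) + m = z by omega]
        exact hz2
      · obtain ⟨s, hs1, hs2, hs⟩ := hback z hz2 (by omega)
        exact absurd ⟨by omega, hs⟩ (hmin (z - s) (by omega))
    obtain ⟨hi₁, hi₂⟩ := Finset.mem_filter.mp hi₀
    set T := (Finset.range (m - k + 1)).filter fun t => D (i₀ + t) with hT
    have h := single i₀ (Finset.mem_range.mp hi₁) T (Finset.filter_subset _ _)
      (by simpa [hT] using hi₂) (fun t ht => (Finset.mem_filter.mp ht).2)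
    set I := (Finset.range m).filter D with hI
    have h1 : I.card ≤ T.card + k := by
      rw [← hcount i₀]
      have hsub : ((Finset.range m).filter fun t => D (i₀ + t)) ⊆
          T ∪ Finset.Ico (m - k + 1) m := by
        intro t ht
        simp only [hT, Finset.mem_union, Finset.mem_filter, Finset.mem_range, Finset.mem_Ico]
          at ht ⊢
        by_cases htm : t < m - k + 1
        · exact Or.inl ⟨htm, ht.2⟩
        · exact Or.inr ⟨by omega, ht.1⟩
      have := (Finset.card_le_card hsub).trans (Finset.card_union_le _ _)
      rw [Nat.card_Ico] at this
      omega
    have h2 : m / k ≤ I.card := by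
      rw [hI, ← Nat.count_eq_card_filter_range]
      exact div_le_count_of_windows hwin
    have h3 : y ^ I.card ≤ y ^ k / L ^ (m / k - k) * (L * y) ^ T.card := by
      have e1 : y ^ I.card ≤ y ^ (T.card + k) := pow_le_pow_right₀ hy h1
      have e2 : L ^ (m / k - k) ≤ L ^ T.card := pow_le_pow_right₀ hL (by omega)
      rw [div_mul_eq_mul_div, le_div_iff₀ (by positivity), mul_pow]
      calc y ^ I.card * L ^ (m / k - k) ≤ y ^ (T.card + k) * L ^ T.card := by gcongr
        _ = _ := by ring
    have h4 : 0 ≤ y ^ T.card := by positivity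
    linarith

/-! ### Arcs of the cyclic order -/

/-- The `k` consecutive elements of `ℤ/n` starting at `x`. -/
def arcFrom {n : ℕ} (k : ℕ) (x : ZMod n) : Finset (ZMod n) :=
  (Finset.range k).image fun j : ℕ => x + j

/-- The arcs of length `k` starting at the multiples `d i`, `i < m`. -/
def alignedArcs (n k d m : ℕ) : Finset (Finset (ZMod n)) :=
  (Finset.range m).image fun i : ℕ => arcFrom k ((d * i : ℕ) : ZMod n)

lemma card_alignedArcs_le (n k d m : ℕ) : (alignedArcs n k d m).card ≤ m :=
  Finset.card_image_le.trans (Finset.card_range m).le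

lemma card_alignedArcs_mem_le (n k d m : ℕ) (z : ZMod n) :
    ((alignedArcs n k d m).filter fun B => z ∈ B).card ≤ k := by
  refine (Finset.card_le_card (t := (Finset.range k).image fun j : ℕ => arcFrom k (z - (j : ZMod n)))
    fun B hB => ?_).trans (Finset.card_image_le.trans (Finset.card_range k).le)
  obtain ⟨h1, h2⟩ := Finset.mem_filter.mp hB
  obtain ⟨i, -, rfl⟩ := Finset.mem_image.mp h1
  obtain ⟨j, hj, rfl⟩ := Finset.mem_image.mp h2
  exact Finset.mem_image.mpr ⟨j, hj, by simp⟩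

lemma natCast_injOn_range (n : ℕ) (x : ZMod n) :
    Set.InjOn (fun j : ℕ => x + (j : ZMod n)) (Finset.range n : Finset ℕ) := by
  intro i hi j hj h
  have h := (ZMod.natCast_eq_natCast_iff' i j n).mp (add_left_cancel h)
  rw [Finset.mem_coe, Finset.mem_range] at hi hj
  rwa [Nat.mod_eq_of_lt hi, Nat.mod_eq_of_lt hj] at h

/-- The second alternative is the part of the arc that wraps round. -/
lemma add_natCast_mem_arcFrom_iff {n k a v : ℕ} (hv : v < n) (ha : a < n) (hk : k ≤ n)
    (x : ZMod n) : x + (a : ZMod n) ∈ arcFrom k (x + (v : ZMod n)) ↔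
      (v ≤ a ∧ a < v + k) ∨ a + n < v + k := by
  simp only [arcFrom, Finset.mem_image, Finset.mem_range]
  constructor
  · rintro ⟨j, hj, h⟩
    rw [add_assoc] at h
    have h := add_left_cancel h
    have h : ((v + j : ℕ) : ZMod n) = (a : ℕ) := by push_cast; exact h
    have h := (ZMod.natCast_eq_natCast_iff' _ _ n).mp h
    rw [Nat.mod_eq_of_lt ha] at h
    by_cases hvj : v + j < n
    · rw [Nat.mod_eq_of_lt hvj] at h
      omega
    · rw [Nat.mod_eq_sub_mod (by omega), Nat.mod_eq_of_lt (by omega)] at h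
      omega
  · rintro (h | h)
    · refine ⟨a - v, by omega, ?_⟩
      rw [add_assoc, ← Nat.cast_add, show v + (a - v) = a by omega]
    · refine ⟨a + n - v, by omega, ?_⟩
      rw [add_assoc, ← Nat.cast_add, show v + (a + n - v) = a + n by omega]
      simp

/-- Only one point of the first arc can be missing from the second. If the offset v is not ±1, two
are missing: the first two points when the second arc does not wrap round, and the last two when it
does. -/
lemma eq_add_one_or_of_subset_arcFrom {n k : ℕ} (hk : 2 ≤ k) (hn : 2 * k ≤ n)
    {S : Finset (ZMod n)} (hS : S.card = k - 1) {x y : ZMod n} (hx : S ⊆ arcFrom k x)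
    (hy : S ⊆ arcFrom k y) (hxy : x ≠ y) : y = x + 1 ∨ x = y + 1 := by
  have : NeZero n := ⟨by omega⟩
  obtain ⟨v, hvn, rfl⟩ : ∃ v : ℕ, v < n ∧ y = x + v :=
    ⟨(y - x).val, ZMod.val_lt _, by rw [ZMod.natCast_zmod_val]; ring⟩
  have key : ∀ a b : ℕ, a < k → b < k → a ≠ b → x + (a : ZMod n) ∉ arcFrom k (x + (v : ZMod n)) →
      x + (b : ZMod n) ∉ arcFrom k (x + (v : ZMod n)) → False := by
    intro a b ha hb hab hav hbv
    have hinj : Set.InjOn (fun j : ℕ => x + (j : ZMod n)) (Finset.range k : Finset ℕ) :=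
      (natCast_injOn_range n x).mono (by
        exact_mod_cast Finset.range_subset_range.mpr (by omega : k ≤ n))
    have hsub : S ⊆ (((Finset.range k).erase a).erase b).image fun j : ℕ => x + (j : ZMod n) := by
      intro s hs
      obtain ⟨j, hj, rfl⟩ := Finset.mem_image.mp (hx hs)
      refine Finset.mem_image.mpr ⟨j, ?_, rfl⟩
      refine Finset.mem_erase.mpr ⟨?_, Finset.mem_erase.mpr ⟨?_, hj⟩⟩
      · rintro rfl; exact hbv (hy hs)
      · rintro rfl; exact hav (hy hs)
    have := (Finset.card_le_card hsub).trans Finset.card_image_le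
    rw [Finset.card_erase_of_mem (Finset.mem_erase.mpr ⟨hab.symm, Finset.mem_range.mpr hb⟩),
      Finset.card_erase_of_mem (Finset.mem_range.mpr ha), Finset.card_range] at this
    omega
  have hv0 : v ≠ 0 := by rintro rfl; simp at hxy
  by_cases h1 : v = 1
  · subst h1; left; simp
  by_cases h2 : v + 1 = n
  · right
    rw [add_assoc, ← Nat.cast_one, ← Nat.cast_add, h2]
    simp
  exfalso
  by_cases h3 : v + k ≤ n
  · refine key 0 1 (by omega) (by omega) (by omega) ?_ ?_ <;>
      rw [add_natCast_mem_arcFrom_iff hvn (by omega) (by omega)] <;> omega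
  · refine key (k - 1) (k - 2) (by omega) (by omega) (by omega) ?_ ?_ <;>
      rw [add_natCast_mem_arcFrom_iff hvn (by omega) (by omega)] <;> omega

/-- Three different arcs with k - 1 common points would have pairwise adjacent starting points,
which is impossible in ℤ/n for n ≥ 4. -/
lemma isStepBound_alignedArcs_one {n k m : ℕ} (hk : 2 ≤ k) (hn : 2 * k ≤ n) :
    IsStepBound 1 k 1 (alignedArcs n k 1 m) := by
  refine Or.inr ⟨rfl, rfl, fun B₀ hB₀ S hS hcard => Finset.card_le_one.mpr ?_⟩
  intro B hB B' hB'
  obtain ⟨h1, h2, h3⟩ := Finset.mem_filter.mp hB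
  obtain ⟨h1', h2', h3'⟩ := Finset.mem_filter.mp hB'
  obtain ⟨i₀, -, rfl⟩ := Finset.mem_image.mp hB₀
  obtain ⟨i, -, rfl⟩ := Finset.mem_image.mp h1
  obtain ⟨j, -, rfl⟩ := Finset.mem_image.mp h1'
  by_contra hne
  have e1 := eq_add_one_or_of_subset_arcFrom hk hn hcard hS h2 (fun h => h3 (by rw [h]))
  have e2 := eq_add_one_or_of_subset_arcFrom hk hn hcard hS h2' (fun h => h3' (by rw [h]))
  have hij : ((1 * i : ℕ) : ZMod n) ≠ ((1 * j : ℕ) : ZMod n) := fun h => hne (by rw [h])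
  have e3 := eq_add_one_or_of_subset_arcFrom hk hn hcard h2 h2' hij
  generalize ((1 * i₀ : ℕ) : ZMod n) = x at *
  generalize ((1 * i : ℕ) : ZMod n) = u at *
  generalize ((1 * j : ℕ) : ZMod n) = w at *
  have hone : ((1 : ℕ) : ZMod n) ≠ 0 := fun h => by
    rw [ZMod.natCast_eq_zero_iff] at h
    have := Nat.le_of_dvd (by omega) h
    omega
  have hthree : ((3 : ℕ) : ZMod n) ≠ 0 := fun h => by
    rw [ZMod.natCast_eq_zero_iff] at h
    have := Nat.le_of_dvd (by omega) h
    omega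
  push_cast at hone hthree
  rcases e1 with e1 | e1 <;> rcases e2 with e2 | e2 <;> rcases e3 with e3 | e3 <;> grind

/-- The indices of the aligned arcs that a permutation of `ℤ/n` maps to aligned arcs. -/
def preservedArcs {n : ℕ} [NeZero n] (k d m : ℕ) (π : Equiv.Perm (ZMod n)) : Finset ℕ :=
  (Finset.range m).filter fun i : ℕ =>
    (arcFrom k ((d * i : ℕ) : ZMod n)).image π ∈ alignedArcs n k d m

lemma image_Ico_eq_image_arcFrom {n : ℕ} (k s t : ℕ) (π : Equiv.Perm (ZMod n)) :
    (Finset.Ico t (t + k)).image (fun j : ℕ => π ((s : ZMod n) + (j : ZMod n))) =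
      (arcFrom k ((s + t : ℕ) : ZMod n)).image π := by
  have h : Finset.Ico t (t + k) = (Finset.range k).image (t + ·) := by
    rw [Finset.range_eq_Ico, Finset.image_add_left_Ico, add_zero]
  rw [arcFrom, Finset.image_image, h, Finset.image_image]
  refine Finset.image_congr fun j _ => ?_
  simp [add_assoc]

/-- `pow_card_le_sum_powerset` is summed over π and the sums are exchanged; for each starting arc i
the inner sum is bounded by `sum_arcPreserving_le`, with Y = y and with Y = Ly. -/
lemma sum_pow_card_preservedArcs_le {k d m n : ℕ} [NeZero n] {y L A F : ℝ}
    (hnm : n = d * m) (hd : 1 ≤ d) (hdk : d < k) (hkm : k ≤ m) (hy : 1 ≤ y) (hL : 1 ≤ L)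
    (hA : IsStepBound A k d (alignedArcs n k d m))
    (hF : ∑ g ∈ Finset.Ico 1 (m - k + 1), stepWeight (L * y) A k d m n g ≤ F) (hF1 : F < 1) :
    ∑ π : Equiv.Perm (ZMod n), y ^ (preservedArcs k d m π).card ≤
      n.factorial * (1 + m * (1 + y ^ k / L ^ (m / k - k)) *
        (L * y * (m * k.factorial) * (Real.exp 1 / n) ^ k / (1 - F))) := by
  classical
  set c := y ^ k / L ^ (m / k - k) with hc
  set E := L * y * (m * k.factorial) * (Real.exp 1 / n) ^ k / (1 - F) with hE
  have hyL : y ≤ L * y := le_mul_of_one_le_left (by linarith) hL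
  have hA0 : 0 ≤ A := le_trans zero_le_one (hA.one_le (by omega))
  have hF' : ∑ g ∈ Finset.Ico 1 (m - k + 1), stepWeight y A k d m n g ≤ F := by
    refine le_trans (Finset.sum_le_sum fun g _ => ?_) hF
    have : 0 ≤ extensionBound A k d m g := by
      unfold extensionBound
      split_ifs <;> positivity
    unfold stepWeight
    gcongr
  -- Positions are counted from the start of the i-th arc, which turns the cyclic pattern into a
  -- linear one.
  let ι : ℕ → ℕ → ZMod n := fun i j => ((d * i : ℕ) : ZMod n) + (j : ZMod n)
  let D : Equiv.Perm (ZMod n) → ℕ → Prop := fun π i =>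
    (arcFrom k ((d * i : ℕ) : ZMod n)).image π ∈ alignedArcs n k d m
  have hD : ∀ π i, D π (i + m) ↔ D π i := by
    intro π i
    simp only [D]
    rw [show ((d * (i + m) : ℕ) : ZMod n) = ((d * i : ℕ) : ZMod n) by
      rw [mul_add, ← hnm, Nat.cast_add, ZMod.natCast_self, add_zero]]
  have hmem : ∀ i T π, (∀ t ∈ T, D π (i + t)) ↔
      π ∈ arcPreserving k d (alignedArcs n k d m) (ι i) T := by
    intro i T π
    rw [mem_arcPreserving]
    refine forall₂_congr fun t _ => ?_
    simp only [ι, D]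
    rw [image_Ico_eq_image_arcFrom, mul_add]
  have hsum : ∀ Y : ℝ, ∀ i T, ∑ π : Equiv.Perm (ZMod n),
      (if 0 ∈ T ∧ ∀ t ∈ T, D π (i + t) then Y ^ T.card else 0) =
      if 0 ∈ T then
        Y ^ T.card * ((arcPreserving k d (alignedArcs n k d m) (ι i) T).card : ℝ) else 0 := by
    intro Y i T
    by_cases h0 : 0 ∈ T
    · simp only [h0, true_and, hmem, if_true]
      rw [← Finset.sum_filter, Finset.sum_const, nsmul_eq_mul, mul_comm]
      simp
    · simp [h0]
  have hQ : ∀ Y : ℝ, 0 ≤ Y →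
      ∑ g ∈ Finset.Ico 1 (m - k + 1), stepWeight Y A k d m n g ≤ F → ∀ i,
      ∑ T ∈ (Finset.range (m - k + 1)).powerset, ∑ π : Equiv.Perm (ZMod n),
        (if 0 ∈ T ∧ ∀ t ∈ T, D π (i + t) then Y ^ T.card else 0) ≤
      n.factorial * (Y * (m * k.factorial) * (Real.exp 1 / n) ^ k / (1 - F)) := by
    intro Y hY hFY i
    simp only [hsum]
    exact sum_arcPreserving_le (ZMod.card n) (natCast_injOn_range n _) hnm hd hdk hkm
      (card_alignedArcs_le n k d m) (card_alignedArcs_mem_le n k d m) hA hY hFY hF1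
  have h1F : 0 < 1 - F := by linarith
  calc ∑ π : Equiv.Perm (ZMod n), y ^ (preservedArcs k d m π).card
      ≤ ∑ π : Equiv.Perm (ZMod n), (1 + ∑ i ∈ Finset.range m,
          ∑ T ∈ (Finset.range (m - k + 1)).powerset,
            ((if 0 ∈ T ∧ ∀ t ∈ T, D π (i + t) then y ^ T.card else 0) +
            c * (if 0 ∈ T ∧ ∀ t ∈ T, D π (i + t) then (L * y) ^ T.card else 0))) := by
        refine Finset.sum_le_sum fun π _ => ?_
        refine le_trans (le_of_eq ?_) ((pow_card_le_sum_powerset (hD π) hy hL (by omega) hkm).trans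
          (le_of_eq ?_))
        · congr 2
          ext i
          simp [preservedArcs, D]
        · congr 1
          refine Finset.sum_congr rfl fun i _ => Finset.sum_congr rfl fun T _ => ?_
          split_ifs <;> simp [hc]
    _ = n.factorial + ∑ i ∈ Finset.range m,
          ((∑ T ∈ (Finset.range (m - k + 1)).powerset, ∑ π : Equiv.Perm (ZMod n),
            (if 0 ∈ T ∧ ∀ t ∈ T, D π (i + t) then y ^ T.card else 0)) +
          c * ∑ T ∈ (Finset.range (m - k + 1)).powerset, ∑ π : Equiv.Perm (ZMod n),
            (if 0 ∈ T ∧ ∀ t ∈ T, D π (i + t) then (L * y) ^ T.card else 0)) := by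
        rw [Finset.sum_add_distrib]
        congr 1
        · simp [Fintype.card_perm, ZMod.card]
        · rw [Finset.sum_comm]
          refine Finset.sum_congr rfl fun i _ => ?_
          rw [Finset.sum_comm]
          simp only [Finset.sum_add_distrib, Finset.mul_sum]
    _ ≤ n.factorial + ∑ i ∈ Finset.range m, (n.factorial * E + c * (n.factorial * E)) := by
        have hc0 : 0 ≤ c := by positivity
        gcongr with i _
        · refine (hQ y (by linarith) hF' i).trans ?_
          rw [hE]
          gcongr
        · exact hQ (L * y) (by positivity) hF i
    _ = _ := by
        rw [Finset.sum_const, Finset.card_range, nsmul_eq_mul]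
        ring

/-! ### Hamilton cycles from cyclic orders -/

lemma cyclicArc_eq_image_arcFrom {n : ℕ} (σ : ZMod n ≃ Fin n) (k s : ℕ) :
    cyclicArc σ k s = (arcFrom k (s : ZMod n)).image σ := by
  rw [cyclicArc, arcFrom, Finset.image_image]
  exact Finset.image_congr fun j _ => by simp

lemma card_arcFrom {n k : ℕ} (hk : k ≤ n) (x : ZMod n) : (arcFrom k x).card = k := by
  rw [arcFrom, Finset.card_image_of_injOn, Finset.card_range]
  exact (natCast_injOn_range n x).mono (by
    exact_mod_cast Finset.range_subset_range.mpr hk)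

/-- The edges of the Hamilton cycle along a cyclic order. -/
def cycleEdge {k n : ℕ} (hk : k ≤ n) (d : ℕ) (σ : ZMod n ≃ Fin n) (i : ℕ) : KSet k n :=
  ⟨cyclicArc σ k (i * d), by
    rw [cyclicArc_eq_image_arcFrom, Finset.card_image_of_injective _ σ.injective, card_arcFrom hk]⟩

/-- The Hamilton cycle along a cyclic order. -/
def hamiltonCycle {k n : ℕ} (hk : k ≤ n) (d m : ℕ) (σ : ZMod n ≃ Fin n) : Finset (KSet k n) :=
  (Finset.range m).image (cycleEdge hk d σ)

/-- Equal arcs contain each other's starting points, which would force n < 2k. -/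
lemma cycleEdge_injOn {k d m n : ℕ} (hk : k ≤ n) (hnm : n = d * m) (hd : 1 ≤ d)
    (h1k : 1 ≤ k) (hn : 2 * k ≤ n) (σ : ZMod n ≃ Fin n) :
    Set.InjOn (cycleEdge hk d σ) (Finset.range m : Finset ℕ) := by
  have key : ∀ i j, i < j → j < m → cycleEdge hk d σ i ≠ cycleEdge hk d σ j := by
    intro i j hij hjm h
    have h := Subtype.ext_iff.mp h
    simp only [cycleEdge, cyclicArc_eq_image_arcFrom] at h
    have h := Finset.image_injective σ.injective h
    have hlt : d * i < d * j := Nat.mul_lt_mul_of_pos_left hij hd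
    have hjn : d * j < n := by rw [hnm]; exact Nat.mul_lt_mul_of_pos_left hjm hd
    rw [mul_comm i, mul_comm j] at h
    have h1 := add_natCast_mem_arcFrom_iff (k := k) hjn (hlt.trans hjn) hk 0
    have h2 := add_natCast_mem_arcFrom_iff (k := k) (hlt.trans hjn) hjn hk 0
    have h3 := add_natCast_mem_arcFrom_iff (k := k) (hlt.trans hjn) (hlt.trans hjn) hk 0
    have h4 := add_natCast_mem_arcFrom_iff (k := k) hjn hjn hk 0
    simp only [zero_add, h] at h1 h2 h3 h4
    have h5 := h1.mp (h3.mpr (Or.inl ⟨le_rfl, by omega⟩))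
    have h6 := h2.mp (h4.mpr (Or.inl ⟨le_rfl, by omega⟩))
    omega
  intro i hi j hj h
  rw [Finset.mem_coe, Finset.mem_range] at hi hj
  rcases lt_trichotomy i j with hij | hij | hij
  · exact absurd h (key i j hij hj)
  · exact hij
  · exact absurd h.symm (key j i hij hi)

lemma card_hamiltonCycle {k d m n : ℕ} (hk : k ≤ n) (hnm : n = d * m) (hd : 1 ≤ d)
    (h1k : 1 ≤ k) (hn : 2 * k ≤ n) (σ : ZMod n ≃ Fin n) : (hamiltonCycle hk d m σ).card = m := by
  rw [hamiltonCycle, Finset.card_image_of_injOn (cycleEdge_injOn hk hnm hd h1k hn σ),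
    Finset.card_range]

lemma card_arcFrom_inter {n k d : ℕ} (hdk : d < k) (hn : 2 * k ≤ n) (x : ZMod n) :
    (arcFrom k x ∩ arcFrom k (x + (d : ZMod n))).card = k - d := by
  have : arcFrom k x ∩ arcFrom k (x + (d : ZMod n)) =
      (Finset.Ico d k).image fun j : ℕ => x + (j : ZMod n) := by
    ext z
    rw [Finset.mem_inter]
    constructor
    · rintro ⟨h1, h2⟩
      obtain ⟨a, ha, rfl⟩ := Finset.mem_image.mp h1
      rw [Finset.mem_range] at ha
      rw [add_natCast_mem_arcFrom_iff (by omega) (by omega) (by omega)] at h2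
      exact Finset.mem_image_of_mem (fun j : ℕ => x + (j : ZMod n))
        (Finset.mem_Ico.mpr ⟨by omega, by omega⟩)
    · intro h
      obtain ⟨a, ha, rfl⟩ := Finset.mem_image.mp h
      rw [Finset.mem_Ico] at ha
      refine ⟨Finset.mem_image_of_mem (fun j : ℕ => x + (j : ZMod n))
        (Finset.mem_range.mpr ha.2), ?_⟩
      rw [add_natCast_mem_arcFrom_iff (by omega) (by omega) (by omega)]
      omega
  rw [this, Finset.card_image_of_injOn, Nat.card_Ico]
  refine (natCast_injOn_range n x).mono fun j hj => ?_
  rw [Finset.mem_coe, Finset.mem_Ico] at hj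
  exact Finset.mem_coe.mpr (Finset.mem_range.mpr (by omega))

lemma isHamiltonCycle_hamiltonCycle {k ℓ m n : ℕ} (hk : k ≤ n) (hnm : n = (k - ℓ) * m)
    (hℓ : 1 ≤ ℓ) (hℓk : ℓ < k) (hn : 2 * k ≤ n) (σ : ZMod n ≃ Fin n) :
    IsHamiltonCycle ℓ (hamiltonCycle hk (k - ℓ) m σ) := by
  have hm : n / (k - ℓ) = m := by rw [hnm, Nat.mul_div_cancel_left _ (by omega)]
  refine ⟨⟨m, hnm⟩, ?_, σ, cycleEdge hk (k - ℓ) σ, fun i => rfl, fun i => ?_, by rw [hm]; rfl⟩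
  · rw [hm]
    exact card_hamiltonCycle hk hnm (by omega) (by omega) hn σ
  · simp only [cycleEdge, cyclicArc_eq_image_arcFrom]
    rw [← Finset.image_inter _ _ σ.injective, Finset.card_image_of_injective _ σ.injective,
      Nat.succ_mul, Nat.cast_add, card_arcFrom_inter (by omega) hn]
    omega

/-- A common edge is the σ-image of one aligned arc and the τ-image of another, so τ⁻¹σ maps the
first arc to the second. -/
lemma card_hamiltonCycle_inter_le {k d m n : ℕ} [NeZero n] (hk : k ≤ n)
    (σ τ : ZMod n ≃ Fin n) :
    (hamiltonCycle hk d m σ ∩ hamiltonCycle hk d m τ).card ≤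
      (preservedArcs k d m (σ.trans τ.symm)).card := by
  refine (Finset.card_le_card (t := (preservedArcs k d m (σ.trans τ.symm)).image
    (cycleEdge hk d σ)) fun e he => ?_).trans Finset.card_image_le
  obtain ⟨h1, h2⟩ := Finset.mem_inter.mp he
  obtain ⟨i, hi, rfl⟩ := Finset.mem_image.mp h1
  obtain ⟨j, hj, hji⟩ := Finset.mem_image.mp h2
  refine Finset.mem_image_of_mem _ (Finset.mem_filter.mpr ⟨hi, ?_⟩)
  have hji := Subtype.ext_iff.mp hji
  simp only [cycleEdge, cyclicArc_eq_image_arcFrom] at hji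
  refine Finset.mem_image.mpr ⟨j, hj, ?_⟩
  rw [Equiv.coe_trans, ← Finset.image_image, mul_comm d i, ← hji, Finset.image_image, mul_comm d j]
  simp

/-- The second moment bound. -/
lemma two_sub_le_measureReal_rainbowHamiltonian {k ℓ m n r : ℕ} [NeZero n] [NeZero r]
    {p : unitInterval} (hnm : n = (k - ℓ) * m) (hℓ : 1 ≤ ℓ) (hℓk : ℓ < k) (hn : 2 * k ≤ n)
    (hp : 0 < (p : ℝ)) {κ : ℝ} (hκ : 1 ≤ κ) (hmr : m ≤ r)
    (h : (r : ℝ) ^ m ≤ κ ^ m * r.descFactorial m) :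
    2 - (∑ π : Equiv.Perm (ZMod n), (κ / p) ^ (preservedArcs k (k - ℓ) m π).card) / n.factorial ≤
      (randomColoredHypergraph k n r p).real {H | RainbowHamiltonian ℓ H} := by
  have hk : k ≤ n := by omega
  have hκp : 1 ≤ κ / p := by
    rw [le_div_iff₀ hp, one_mul]
    exact p.2.2.trans hκ
  let A : (ZMod n ≃ Fin n) → Set (ColoredHypergraph k n r) := fun σ =>
    rainbowEvent r (hamiltonCycle hk (k - ℓ) m σ)
  have hC : ∀ σ : ZMod n ≃ Fin n, (hamiltonCycle hk (k - ℓ) m σ).card = m :=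
    card_hamiltonCycle hk hnm (by omega) (by omega) hn
  set a : ℝ := r.descFactorial m * ((p : ℝ) / r) ^ m with ha
  have hA : ∀ σ, (randomColoredHypergraph k n r p).real (A σ) = a := fun σ => by
    rw [measureReal_rainbowEvent, hC]
  have hr : (0 : ℝ) < r := by exact_mod_cast Nat.pos_of_ne_zero (NeZero.ne r)
  have ha0 : 0 < a := by
    have : (0 : ℝ) < r.descFactorial m := by
      exact_mod_cast Nat.pos_of_ne_zero (by rw [Ne, Nat.descFactorial_eq_zero_iff_lt]; omega)
    positivity
  have hcard : Fintype.card (ZMod n ≃ Fin n) = n.factorial := by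
    rw [Fintype.card_equiv (ZMod.finEquiv n).symm.toEquiv, ZMod.card]
  have hs : ∑ σ, (randomColoredHypergraph k n r p).real (A σ) = n.factorial * a := by
    simp [hA, hcard]
  set Z := ∑ π : Equiv.Perm (ZMod n), (κ / p) ^ (preservedArcs k (k - ℓ) m π).card with hZ
  have hss : ∑ σ, ∑ τ, (randomColoredHypergraph k n r p).real (A σ ∩ A τ) ≤
      n.factorial * (a ^ 2 * Z) := by
    calc _ ≤ ∑ _σ : ZMod n ≃ Fin n, a ^ 2 * Z := by
          refine Finset.sum_le_sum fun σ _ => ?_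
          -- The substitution π = τ⁻¹σ makes the bound for the inner sum independent of σ.
          let e : (ZMod n ≃ Fin n) ≃ Equiv.Perm (ZMod n) :=
            ⟨fun τ => σ.trans τ.symm, fun π => π.symm.trans σ, fun τ => by ext; simp,
              fun π => by ext; simp⟩
          rw [hZ, Finset.mul_sum, ← Equiv.sum_comp e]
          refine Finset.sum_le_sum fun τ _ => ?_
          refine (measureReal_rainbowEvent_inter_le_mul hp (by linarith) hmr h (hC σ) (hC τ)).trans ?_
          gcongr
          exact card_hamiltonCycle_inter_le hk σ τ
      _ = _ := by simp [hcard]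
  have hsub : (⋃ σ, A σ) ⊆ {H : ColoredHypergraph k n r | RainbowHamiltonian ℓ H} := by
    intro H hH
    obtain ⟨σ, hσ⟩ := Set.mem_iUnion.mp hH
    exact ⟨_, isHamiltonCycle_hamiltonCycle hk hnm hℓ hℓk hn σ, hσ⟩
  have hfac : (0 : ℝ) < n.factorial := by exact_mod_cast Nat.factorial_pos n
  refine le_trans ?_ ((two_sub_le_measureReal_iUnion (randomColoredHypergraph k n r p) (A := A)
    (fun σ => (Set.toFinite _).measurableSet) (by rw [hs]; positivity)).trans
    (measureReal_mono hsub))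
  rw [hs]
  refine sub_le_sub_left ?_ 2
  rw [div_le_div_iff₀ (by positivity) hfac]
  calc _ ≤ n.factorial * (a ^ 2 * Z) * n.factorial := by gcongr
    _ = _ := by ring

/-- The first moment bound. -/
lemma measureReal_rainbowHamiltonian_le {k ℓ n r : ℕ} [NeZero n] [NeZero r] (p : unitInterval) :
    (randomColoredHypergraph k n r p).real {H | RainbowHamiltonian ℓ H} ≤
      n.factorial * (r.descFactorial (n / (k - ℓ)) * ((p : ℝ) / r) ^ (n / (k - ℓ))) := by
  classical
  set 𝓒 : Finset (Finset (KSet k n)) := Finset.univ.filter (IsHamiltonCycle ℓ) with h𝓒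
  -- A cycle arises from several cyclic orders; for an upper bound this overcounting is harmless.
  have hcard : 𝓒.card ≤ n.factorial := by
    have : Fintype.card (ZMod n ≃ Fin n) = n.factorial := by
      rw [Fintype.card_equiv (ZMod.finEquiv n).symm.toEquiv, ZMod.card]
    rw [← this, ← Finset.card_univ]
    refine Finset.card_le_card_of_forall_subsingleton (fun C σ => ∃ E : ℕ → KSet k n,
      (∀ i, (E i : Finset (Fin n)) = cyclicArc σ k (i * (k - ℓ))) ∧
        C = (Finset.range (n / (k - ℓ))).image E) ?_ ?_
    · intro C hC
      obtain ⟨-, -, σ, E, h1, -, h2⟩ := (Finset.mem_filter.mp hC).2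
      exact ⟨σ, Finset.mem_univ _, E, h1, h2⟩
    · rintro σ _ C ⟨_, E, h1, rfl⟩ C' ⟨_, E', h1', rfl⟩
      have : E = E' := funext fun i => Subtype.ext ((h1 i).trans (h1' i).symm)
      rw [this]
  have hsub : {H : ColoredHypergraph k n r | RainbowHamiltonian ℓ H} ⊆
      ⋃ C ∈ 𝓒, rainbowEvent r C := by
    rintro H ⟨C, hC, h⟩
    exact Set.mem_biUnion (Finset.mem_filter.mpr ⟨Finset.mem_univ _, hC⟩) h
  refine (measureReal_mono hsub (measure_ne_top _ _)).trans ((measureReal_biUnion_finset_le _ _).trans ?_)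
  have hp : 0 ≤ (p : ℝ) / r := div_nonneg p.2.1 (Nat.cast_nonneg _)
  calc ∑ C ∈ 𝓒, (randomColoredHypergraph k n r p).real (rainbowEvent r C)
      = ∑ _C ∈ 𝓒, (r.descFactorial (n / (k - ℓ)) * ((p : ℝ) / r) ^ (n / (k - ℓ))) := by
        refine Finset.sum_congr rfl fun C hC => ?_
        rw [measureReal_rainbowEvent, (Finset.mem_filter.mp hC).2.2.1]
    _ ≤ _ := by
        rw [Finset.sum_const, nsmul_eq_mul]
        gcongr

/-! ### Asymptotics along the multiples of `d` -/

lemma atTopMultiples_le_atTop (d : ℕ) : atTopMultiples d ≤ atTop := inf_le_left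

lemma eventually_dvd_atTopMultiples (d : ℕ) : ∀ᶠ n in atTopMultiples d, d ∣ n :=
  mem_inf_of_right (mem_principal_self _)

lemma eventually_ge_atTopMultiples (d N : ℕ) : ∀ᶠ n in atTopMultiples d, N ≤ n :=
  (eventually_ge_atTop N).filter_mono (atTopMultiples_le_atTop d)

lemma tendsto_cast_atTopMultiples (d : ℕ) :
    Tendsto (fun n : ℕ => (n : ℝ)) (atTopMultiples d) atTop :=
  tendsto_natCast_atTop_atTop.mono_left (atTopMultiples_le_atTop d)

lemma tendsto_div_atTopMultiples {d : ℕ} (hd : 1 ≤ d) :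
    Tendsto (fun n : ℕ => n / d) (atTopMultiples d) atTop :=
  (Nat.tendsto_div_const_atTop (by omega)).mono_left (atTopMultiples_le_atTop d)

lemma tendsto_const_div_atTopMultiples (d : ℕ) (a : ℝ) :
    Tendsto (fun n : ℕ => a / (n : ℝ)) (atTopMultiples d) (𝓝 0) :=
  (tendsto_cast_atTopMultiples d).const_div_atTop a

lemma tendsto_colorCount_div {d : ℕ} {c : ℝ} {r : ℕ → ℕ} (hr : IsColorCount d c r) :
    Tendsto (fun n : ℕ => (r n : ℝ) / n) (atTopMultiples d) (𝓝 c) := by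
  rw [tendsto_iff_norm_sub_tendsto_zero]
  refine squeeze_zero' (Eventually.of_forall fun n => norm_nonneg _) ?_
    (tendsto_const_div_atTopMultiples d 1)
  filter_upwards [hr, eventually_ge_atTopMultiples d 1] with n hn h1
  have h1' : (0 : ℝ) < n := by exact_mod_cast h1
  rw [Real.norm_eq_abs, show (r n : ℝ) / n - c = (r n - c * n) / n by field_simp, abs_div,
    abs_of_pos h1']
  gcongr

lemma tendsto_log_colorCount_div {d : ℕ} {c : ℝ} {r : ℕ → ℕ} (hc : 0 < c)
    (hr : IsColorCount d c r) :
    Tendsto (fun n : ℕ => (1 + Real.log (r n + 1)) / (n : ℝ)) (atTopMultiples d) (𝓝 0) := by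
  have hlog : Tendsto (fun n : ℕ => Real.log n / (n : ℝ)) (atTopMultiples d) (𝓝 0) :=
    (Real.isLittleO_log_id_atTop.tendsto_div_nhds_zero).comp (tendsto_cast_atTopMultiples d)
  have hup : Tendsto (fun n : ℕ => (1 + Real.log (c + 2)) / (n : ℝ) + Real.log n / (n : ℝ))
      (atTopMultiples d) (𝓝 0) := by
    simpa using (tendsto_const_div_atTopMultiples d (1 + Real.log (c + 2))).add hlog
  refine squeeze_zero' ?_ ?_ hup
  · refine Eventually.of_forall fun n => ?_
    have : 0 ≤ Real.log ((r n : ℝ) + 1) := Real.log_nonneg (by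
      have : (0 : ℝ) ≤ r n := by positivity
      linarith)
    positivity
  · filter_upwards [hr, eventually_ge_atTopMultiples d 1] with n hn h1
    have h1' : (1 : ℝ) ≤ n := by exact_mod_cast h1
    rw [← add_div]
    refine div_le_div_of_nonneg_right ?_ (by positivity)
    rw [add_assoc, ← Real.log_mul (by positivity) (by positivity)]
    refine add_le_add_right (Real.log_le_log (by positivity) ?_) 1
    have := (abs_lt.mp hn).2
    nlinarith

lemma rainbowRate_of_eq {d : ℕ} (hd : 1 ≤ d) {c : ℝ} (hc : c = 1 / d) : rainbowRate d c = 0 := by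
  have : (d : ℝ) ≠ 0 := by positivity
  rw [rainbowRate, hc, mul_one_div_cancel this]
  simp

lemma eventually_div_le_colorCount {d : ℕ} (hd : 1 ≤ d) {c : ℝ} {r : ℕ → ℕ} (hc : 1 / (d : ℝ) ≤ c)
    (hr : IsColorCount d c r) : ∀ᶠ n in atTopMultiples d, n / d ≤ r n := by
  have hd0 : (d : ℝ) ≠ 0 := by positivity
  filter_upwards [hr, eventually_dvd_atTopMultiples d] with n hn hdn
  have h2 : ((n / d : ℕ) : ℝ) < r n + 1 := by
    rw [Nat.cast_div hdn hd0]
    have h1 : (n : ℝ) / d ≤ c * n := by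
      rw [div_eq_mul_one_div, mul_comm]
      gcongr
    have := (abs_lt.mp hn).1
    linarith
  have : n / d < r n + 1 := by exact_mod_cast h2
  omega

/-- For c > 1/d this is continuity of the logarithm, after dividing both r and r - n/d by n. -/
lemma tendsto_rainbowRate {d : ℕ} (hd : 1 ≤ d) {c : ℝ} {r : ℕ → ℕ} (hc : 1 / (d : ℝ) ≤ c)
    (hr : IsColorCount d c r) :
    Tendsto (fun n : ℕ => ((r n - n / d : ℕ) : ℝ) *
      (Real.log (r n) - Real.log ((r n - n / d : ℕ) : ℝ)) * (d / n)) (atTopMultiples d)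
      (𝓝 (rainbowRate d c)) := by
  have hd0 : (0 : ℝ) < d := by positivity
  rcases hc.eq_or_lt with hc | hc
  · rw [rainbowRate_of_eq hd hc.symm]
    -- For c = 1/d the number cn is an integer, so r = n/d exactly and the expression vanishes;
    -- continuity would fail here because of log 0.
    refine (tendsto_const_nhds (x := (0 : ℝ))).congr' ?_
    filter_upwards [hr, eventually_dvd_atTopMultiples d] with n hn hdn
    have h1 : c * n = ((n / d : ℕ) : ℝ) := by
      rw [Nat.cast_div hdn hd0.ne', ← hc, one_div_mul_eq_div]
    rw [h1] at hn
    have h2 : |((r n : ℤ) - (n / d : ℕ) : ℤ)| < 1 := by exact_mod_cast hn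
    rw [abs_lt] at h2
    have : r n - n / d = 0 := by omega
    rw [this]
    simp
  · have hc0 : 0 < c := lt_trans (by positivity) hc
    have hc' : c - 1 / (d : ℝ) ≠ 0 := by linarith
    have h1 := tendsto_colorCount_div hr
    have h2 : Tendsto (fun n : ℕ => ((r n - n / d : ℕ) : ℝ) / n) (atTopMultiples d)
        (𝓝 (c - 1 / d)) := by
      refine (h1.sub_const (1 / (d : ℝ))).congr' ?_
      filter_upwards [eventually_div_le_colorCount hd hc.le hr, eventually_dvd_atTopMultiples d,
        eventually_ge_atTopMultiples d 1] with n hn hdn hn1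
      have : (n : ℝ) ≠ 0 := by positivity
      rw [Nat.cast_sub hn, Nat.cast_div hdn hd0.ne']
      field_simp
    have h3 := ((h2.mul ((h1.log hc0.ne').sub (h2.log hc'))).mul_const (d : ℝ))
    have e : (c - 1 / (d : ℝ)) * (Real.log c - Real.log (c - 1 / d)) * d = rainbowRate d c := by
      rw [rainbowRate]
      field_simp
    rw [e] at h3
    refine h3.congr' ?_
    have h1p := h1.eventually (lt_mem_nhds hc0)
    have h2p := h2.eventually (lt_mem_nhds (sub_pos.mpr hc))
    filter_upwards [h1p, h2p, eventually_ge_atTopMultiples d 1] with n ha hb hn1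
    have hn0 : (n : ℝ) ≠ 0 := by positivity
    have hra : (r n : ℝ) ≠ 0 := fun h => by simp [h] at ha
    have hsa : ((r n - n / d : ℕ) : ℝ) ≠ 0 := fun h => by simp [h] at hb
    rw [Real.log_div hra hn0, Real.log_div hsa hn0]
    ring

lemma eventually_log_descFactorial_div_pow {d : ℕ} (hd : 1 ≤ d) {c : ℝ} {r : ℕ → ℕ}
    (hc : 1 / (d : ℝ) ≤ c) (hr : IsColorCount d c r) {δ : ℝ} (hδ : 0 < δ) :
    ∀ᶠ n in atTopMultiples d,
      |Real.log ((r n).descFactorial (n / d) / (r n : ℝ) ^ (n / d)) + (n / d : ℕ) -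
        (n / d : ℕ) * rainbowRate d c| ≤ δ * (n / d : ℕ) := by
  have hd0 : (0 : ℝ) < d := by positivity
  have hc0 : 0 < c := lt_of_lt_of_le (by positivity) hc
  have h1 := (tendsto_rainbowRate hd hc hr).eventually (Metric.ball_mem_nhds _ (half_pos hδ))
  have h2 := (tendsto_log_colorCount_div hc0 hr).eventually
    (gt_mem_nhds (show 0 < δ / (2 * d) by positivity))
  filter_upwards [h1, h2, eventually_div_le_colorCount hd hc hr, eventually_dvd_atTopMultiples d,
    eventually_ge_atTopMultiples d d] with n h1 h2 h3 hdn hn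
  have hn0 : (0 : ℝ) < n := by
    have : 0 < n := by omega
    exact_mod_cast this
  have hm1 : 1 ≤ n / d := (Nat.one_le_div_iff (by omega)).mpr hn
  have h4 := log_descFactorial_div_pow_bounds h3 (by omega)
  have hm : ((n / d : ℕ) : ℝ) = n / d := Nat.cast_div hdn hd0.ne'
  rw [Real.dist_eq] at h1
  set s := ((r n - n / d : ℕ) : ℝ) * (Real.log (r n) - Real.log ((r n - n / d : ℕ) : ℝ))
  set m : ℝ := ((n / d : ℕ) : ℝ)
  have hmd : (d : ℝ) / n * m = 1 := by rw [hm]; field_simp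
  have hm0 : 0 < m := by rw [hm]; positivity
  have h5 : |s - m * rainbowRate d c| ≤ δ / 2 * m := by
    have e : s - m * rainbowRate d c = (s * (d / n) - rainbowRate d c) * m := by
      linear_combination (-s) * hmd
    rw [e, abs_mul, abs_of_pos hm0]
    gcongr
  have h6 : 1 + Real.log (r n + 1) ≤ δ / 2 * m := by
    rw [div_lt_iff₀ hn0] at h2
    refine h2.le.trans (le_of_eq ?_)
    rw [hm]
    field_simp
  rw [abs_le] at h4 h5 ⊢
  constructor <;> linarith [h4.1, h4.2, h5.1, h5.2]

lemma rainbowThreshold_eq {k ℓ : ℕ} (hℓk : ℓ < k) {c : ℝ} (hc : 1 / ((k : ℝ) - ℓ) ≤ c) (n : ℕ) :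
    rainbowThreshold k ℓ c n =
      Real.exp ((k - ℓ : ℕ) + 1 - rainbowRate (k - ℓ) c) / (n : ℝ) ^ (k - ℓ) := by
  have hcast : ((k - ℓ : ℕ) : ℝ) = (k : ℝ) - ℓ := Nat.cast_sub hℓk.le
  have hd0 : (0 : ℝ) < (k : ℝ) - ℓ := by
    rw [← hcast]
    exact_mod_cast (by omega : 0 < k - ℓ)
  rw [rainbowThreshold]
  split_ifs with h
  · rw [rainbowRate_of_eq (by omega) (by rw [hcast]; exact h), hcast, sub_zero]
  · have hc1 : 0 < c - 1 / ((k : ℝ) - ℓ) := sub_pos.mpr (lt_of_le_of_ne hc (Ne.symm h))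
    have hc0 : 0 < c := lt_of_lt_of_le (by positivity) hc
    rw [Real.rpow_def_of_pos (by positivity), ← Real.exp_add, rainbowRate, hcast,
      Real.log_div hc1.ne' hc0.ne']
    congr 2
    ring

lemma tightThreshold_eq (k : ℕ) (hk : 1 ≤ k) (c : ℝ) :
    tightThreshold c = rainbowThreshold k (k - 1) c := by
  funext n
  have h1 : (k : ℝ) - ((k - 1 : ℕ) : ℝ) = 1 := by push_cast [hk]; ring
  have h2 : k - (k - 1) = 1 := by omega
  simp only [tightThreshold, rainbowThreshold, h1, h2, div_one, pow_one, one_mul]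
  norm_num

/-! ### The first moment method -/

/-- Below the threshold by a factor e^(-2δ), the first moment is at most e(n + 1) e^(-δm): half of
the slack absorbs the error in the rainbow rate, and the other half beats the polynomial factor. -/
lemma whpNotRainbow_of_le {k ℓ : ℕ} (hℓk : ℓ < k) {c : ℝ} (hc : 1 / ((k : ℝ) - ℓ) ≤ c)
    {r : ℕ → ℕ} (hr : IsColorCount (k - ℓ) c r) {ε : ℝ} (hε : 0 < ε) {p : ℕ → unitInterval}
    (hp : ∀ᶠ n : ℕ in atTopMultiples (k - ℓ), (p n : ℝ) ≤ (1 - ε) * rainbowThreshold k ℓ c n) :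
    WhpNotRainbow k ℓ r p := by
  have hcast : ((k - ℓ : ℕ) : ℝ) = (k : ℝ) - ℓ := Nat.cast_sub hℓk.le
  have hthr := fun n => rainbowThreshold_eq hℓk hc n
  rw [← hcast] at hc
  unfold WhpNotRainbow
  set d := k - ℓ with hd_def
  have hd : 1 ≤ d := by omega
  have hd0 : (0 : ℝ) < d := by positivity
  -- Truncation keeps 1 - η positive, so that it has a logarithm even when ε ≥ 1.
  set η := min ε (1 / 2) with hη
  have hη0 : 0 < η := by positivity
  have hη1 : η ≤ 1 / 2 := min_le_right _ _
  set δ := - Real.log (1 - η) / 2 with hδ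
  have hδ0 : 0 < δ := by
    have : Real.log (1 - η) < 0 := Real.log_neg (by linarith) (by linarith)
    rw [hδ]
    linarith
  have hηδ : 1 - η = Real.exp (-(2 * δ)) := by
    rw [hδ, show -(2 * (-Real.log (1 - η) / 2)) = Real.log (1 - η) by ring,
      Real.exp_log (by linarith)]
  have hq : Real.exp (-δ) < 1 := Real.exp_lt_one_iff.mpr (by linarith)
  have hlim : Tendsto (fun m : ℕ => Real.exp 1 * ((d * m + 1) * Real.exp (-δ) ^ m)) atTop (𝓝 0) := by
    have h1 := tendsto_self_mul_const_pow_of_lt_one (Real.exp_pos (-δ)).le hq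
    have h2 := tendsto_pow_atTop_nhds_zero_of_lt_one (Real.exp_pos (-δ)).le hq
    have h3 := ((h1.const_mul (d : ℝ)).add h2).const_mul (Real.exp 1)
    simp only [mul_zero, add_zero] at h3
    refine h3.congr fun m => ?_
    ring
  have hlim := hlim.comp (tendsto_div_atTopMultiples hd)
  have hlow : Tendsto (fun n : ℕ => 1 - Real.exp 1 *
      ((d * (n / d : ℕ) + 1) * Real.exp (-δ) ^ (n / d))) (atTopMultiples d) (𝓝 1) := by
    simpa using hlim.const_sub 1
  have hev := eventually_log_descFactorial_div_pow hd hc hr hδ0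
  have hmain : ∀ᶠ n in atTopMultiples d,
      1 - Real.exp 1 * ((d * (n / d : ℕ) + 1) * Real.exp (-δ) ^ (n / d)) ≤
        (randomColoredHypergraph k n (r n) (p n)).real {H | ¬ RainbowHamiltonian ℓ H} ∧
      (randomColoredHypergraph k n (r n) (p n)).real {H | ¬ RainbowHamiltonian ℓ H} ≤ 1 := by
    filter_upwards [hev, hp, eventually_div_le_colorCount hd hc hr,
      eventually_dvd_atTopMultiples d, eventually_ge_atTopMultiples d d] with n h1 h2 h3 hdn hn
    have : NeZero n := ⟨by omega⟩
    have hm1 : 1 ≤ n / d := (Nat.one_le_div_iff (by omega)).mpr hn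
    have : NeZero (r n) := ⟨by omega⟩
    refine ⟨?_, measureReal_le_one⟩
    have hcompl : (randomColoredHypergraph k n (r n) (p n)).real {H | ¬ RainbowHamiltonian ℓ H} =
        1 - (randomColoredHypergraph k n (r n) (p n)).real {H | RainbowHamiltonian ℓ H} :=
      probReal_compl_eq_one_sub (Set.toFinite _).measurableSet
    rw [hcompl]
    refine sub_le_sub_left ((measureReal_rainbowHamiltonian_le (p n)).trans ?_) 1
    rw [← hd_def]
    set m := n / d with hm
    have hnm : n = d * m := (Nat.mul_div_cancel' hdn).symm
    have hnm' : (n : ℝ) = d * m := by exact_mod_cast hnm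
    have hn0 : (0 : ℝ) < n := by
      have : 0 < n := by omega
      exact_mod_cast this
    have hr0 : (0 : ℝ) < r n := by
      have : 0 < r n := by omega
      exact_mod_cast this
    have hD : (0 : ℝ) < (r n).descFactorial m := by
      exact_mod_cast Nat.pos_of_ne_zero (by rw [Ne, Nat.descFactorial_eq_zero_iff_lt]; omega)
    set R := rainbowRate d c
    have hρ : ((r n).descFactorial m : ℝ) / (r n : ℝ) ^ m ≤ Real.exp (m * (R - 1 + δ)) := by
      rw [← Real.log_le_iff_le_exp (by positivity)]
      have := (abs_le.mp h1).2
      linarith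
    have hpb : (p n : ℝ) ≤ Real.exp (-(2 * δ)) * (Real.exp (d + 1 - R) / (n : ℝ) ^ d) := by
      rw [hthr] at h2
      refine h2.trans ?_
      rw [← hηδ]
      gcongr
      exact min_le_left _ _
    have hpm : (p n : ℝ) ^ m ≤ Real.exp (m * (-(2 * δ) + (d + 1 - R))) / (n : ℝ) ^ n := by
      refine (pow_le_pow_left₀ (p n).2.1 hpb m).trans (le_of_eq ?_)
      rw [mul_div_assoc', ← Real.exp_add, div_pow, ← Real.exp_nat_mul, ← pow_mul, ← hnm]
    have hfac : (n.factorial : ℝ) ≤ Real.exp 1 * (n + 1) * (n : ℝ) ^ n * Real.exp (-n) := by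
      rw [Real.exp_neg, ← div_eq_mul_inv, le_div_iff₀ (Real.exp_pos _)]
      exact factorial_mul_exp_le n
    calc (n.factorial : ℝ) * ((r n).descFactorial m * ((p n : ℝ) / r n) ^ m)
        = n.factorial * (((r n).descFactorial m / (r n : ℝ) ^ m) * (p n : ℝ) ^ m) := by
          rw [div_pow]; ring
      _ ≤ (Real.exp 1 * (n + 1) * (n : ℝ) ^ n * Real.exp (-n)) * (Real.exp (m * (R - 1 + δ)) *
          (Real.exp (m * (-(2 * δ) + (d + 1 - R))) / (n : ℝ) ^ n)) := by
          have := pow_nonneg (p n).2.1 m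
          gcongr
      _ = Real.exp 1 * (n + 1) * (Real.exp (-n) * Real.exp (m * (R - 1 + δ)) *
          Real.exp (m * (-(2 * δ) + (d + 1 - R)))) := by
          field_simp
      _ = Real.exp 1 * ((d * m + 1) * Real.exp (-δ) ^ m) := by
          rw [← Real.exp_add, ← Real.exp_add, ← Real.exp_nat_mul, hnm', ← mul_assoc]
          congr 2
          ring
  exact tendsto_of_tendsto_of_tendsto_of_le_of_le' hlow tendsto_const_nhds
    (hmain.mono fun _ h => h.1) (hmain.mono fun _ h => h.2)

/-! ### The second moment method -/

/-- The three terms come from g = 1, from the fewer than k overlapping distances g ≥ 2 (where dg ≥ d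
+ 1 yields another e/n), and from at most m disjoint distances, each with m choices of an arc and a
further factor (e/n)^ℓ. -/
lemma sum_stepWeight_le {k ℓ m n : ℕ} {Y A B : ℝ} (hℓk : ℓ < k)
    (hℓ : 1 ≤ ℓ) (hn : Real.exp 1 ≤ n) (hmn : m ≤ n) (hA : 1 ≤ A) (hY : 0 ≤ Y)
    (hYA : Y * A * (Real.exp 1 / n) ^ (k - ℓ) ≤ B) :
    ∑ g ∈ Finset.Ico 1 (m - k + 1), stepWeight Y A k (k - ℓ) m n g ≤
      B * (1 + k * (k * k.factorial) * (Real.exp 1 / n) +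
        k.factorial * Real.exp 1 ^ ℓ * ((n : ℝ) ^ 2 / (n : ℝ) ^ ℓ)) := by
  set x := Real.exp 1 / (n : ℝ) with hx
  set d := k - ℓ with hd
  have hn0 : (0 : ℝ) < n := (Real.exp_pos 1).trans_le hn
  have hx0 : 0 ≤ x := by positivity
  have hx1 : x ≤ 1 := (div_le_one hn0).mpr hn
  have hYB : Y * x ^ d ≤ B := by
    refine le_trans ?_ hYA
    rw [mul_right_comm]
    exact le_mul_of_one_le_right (by positivity) hA
  have hB : 0 ≤ B := le_trans (by positivity) hYB
  set a := B * (k * k.factorial) * x with ha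
  set b := B * (m * k.factorial) * x ^ ℓ with hb
  have ha0 : 0 ≤ a := by positivity
  have hb0 : 0 ≤ b := by positivity
  have hterm : ∀ g ∈ Finset.Ico 1 (m - k + 1), stepWeight Y A k d m n g ≤
      (if g = 1 then B else 0) + ((if g < k then a else 0) + b) := by
    intro g hg
    rw [Finset.mem_Ico] at hg
    unfold stepWeight extensionBound
    rw [← hx]
    by_cases h1 : g = 1
    · subst h1
      rw [if_pos rfl, if_pos rfl, mul_one, min_eq_left (by omega)]
      have : 0 ≤ (if 1 < k then a else 0) + b := by split_ifs <;> linarith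
      linarith
    · rw [if_neg h1, if_neg h1, zero_add]
      have hgd : g ≤ d * g := Nat.le_mul_of_pos_left g (by omega)
      split_ifs with h2 h3
      · have h5 : d + 1 ≤ d * g := by
          have : d * 2 ≤ d * g := Nat.mul_le_mul_left _ (by omega)
          omega
        rw [min_eq_left h2.le]
        calc Y * (k * k.factorial) * x ^ (d * g) ≤ Y * (k * k.factorial) * x ^ (d + 1) := by
              gcongr Y * (k * k.factorial) * ?_
              exact pow_le_pow_of_le_one hx0 hx1 h5
          _ = (Y * x ^ d) * (k * k.factorial) * x := by ring
          _ ≤ a := by rw [ha]; gcongr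
          _ ≤ a + b := by linarith
      · omega
      all_goals
        rw [min_eq_right (by omega), show x ^ k = x ^ d * x ^ ℓ by rw [← pow_add]; congr 1; omega]
        calc Y * (m * k.factorial) * (x ^ d * x ^ ℓ)
            = (Y * x ^ d) * (m * k.factorial) * x ^ ℓ := by ring
          _ ≤ b := by rw [hb]; gcongr
          _ ≤ _ := by linarith
  refine (Finset.sum_le_sum hterm).trans ?_
  rw [Finset.sum_add_distrib, Finset.sum_add_distrib, ← Finset.sum_filter, ← Finset.sum_filter,
    Finset.sum_const, Finset.sum_const, Finset.sum_const]
  simp only [nsmul_eq_mul]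
  have c1 : ((((Finset.Ico 1 (m - k + 1)).filter fun g => g = 1).card : ℕ) : ℝ) ≤ 1 := by
    exact_mod_cast (Finset.card_le_card (t := {1}) fun g hg => by
      simpa using (Finset.mem_filter.mp hg).2).trans (Finset.card_singleton 1).le
  have c2 : ((((Finset.Ico 1 (m - k + 1)).filter fun g => g < k).card : ℕ) : ℝ) ≤ k := by
    exact_mod_cast (Finset.card_le_card (t := Finset.range k) fun g hg => by
      simpa using (Finset.mem_filter.mp hg).2).trans (Finset.card_range k).le
  have c3 : (((Finset.Ico 1 (m - k + 1)).card : ℕ) : ℝ) ≤ m := by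
    rw [Nat.card_Ico]
    exact_mod_cast (by omega)
  have hmn' : (m : ℝ) ≤ n := by exact_mod_cast hmn
  calc _ ≤ 1 * B + (k * a + m * b) := by gcongr
    _ = B * (1 + k * (k * k.factorial) * x + k.factorial * ((m : ℝ) ^ 2 * x ^ ℓ)) := by
      rw [ha, hb]; ring
    _ ≤ B * (1 + k * (k * k.factorial) * x + k.factorial * ((n : ℝ) ^ 2 * x ^ ℓ)) := by gcongr
    _ = _ := by
      rw [hx, div_pow]
      ring

lemma eventually_pow_le_pow_div {d k : ℕ} (hd : 1 ≤ d) (hk : 1 ≤ k) {L : ℝ} (hL : 1 < L) (a : ℕ) :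
    ∀ᶠ n : ℕ in atTopMultiples d, (n : ℝ) ^ a ≤ L ^ (n / d / k - k) := by
  have h1 : Tendsto (fun q : ℕ => (2 * d * k : ℝ) ^ a * L ^ k * ((q : ℝ) ^ a / L ^ q)) atTop
      (𝓝 0) := by
    simpa using (tendsto_pow_const_div_const_pow_of_one_lt a hL).const_mul
      ((2 * d * k : ℝ) ^ a * L ^ k)
  have h2 : Tendsto (fun n : ℕ => n / d / k) (atTopMultiples d) atTop :=
    (Nat.tendsto_div_const_atTop (by omega)).comp (tendsto_div_atTopMultiples hd)
  filter_upwards [(h1.comp h2).eventually (gt_mem_nhds one_pos), h2.eventually_ge_atTop (k + 1),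
    eventually_dvd_atTopMultiples d] with n h3 h4 hdn
  set q := n / d / k with hq
  have hL0 : 0 < L := by linarith
  have h5 : n ≤ 2 * d * k * q := by
    have e1 : n = d * (n / d) := (Nat.mul_div_cancel' hdn).symm
    have e2 : n / d < k * (q + 1) := by
      rw [hq]
      exact Nat.lt_mul_div_succ _ (by omega)
    have e3 : n / d ≤ k * (2 * q) := e2.le.trans (Nat.mul_le_mul_left _ (by omega))
    calc n = d * (n / d) := e1
      _ ≤ d * (k * (2 * q)) := Nat.mul_le_mul_left _ e3
      _ = _ := by ring
  have h6 : (n : ℝ) ≤ 2 * d * k * q := by exact_mod_cast h5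
  simp only [Function.comp_apply, ← hq] at h3
  rw [mul_div_assoc', div_lt_one (by positivity)] at h3
  have h7 : L ^ q = L ^ (q - k) * L ^ k := by rw [← pow_add]; congr 1; omega
  refine le_of_mul_le_mul_right ?_ (show 0 < L ^ k by positivity)
  calc (n : ℝ) ^ a * L ^ k ≤ (2 * d * k * q) ^ a * L ^ k := by gcongr
    _ = (2 * d * k : ℝ) ^ a * L ^ k * (q : ℝ) ^ a := by rw [mul_pow _ (q : ℝ)]; ring
    _ ≤ L ^ q := h3.le
    _ = _ := h7

/-- If the edge probability exceeds the growth rate `A e^(k-ℓ) κ / n^(k-ℓ)` by a factor `1 / θ`,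
then the second moment method gives a rainbow Hamilton cycle. -/
lemma whpRainbow_of_secondMoment {k ℓ : ℕ} (hℓ : 1 ≤ ℓ) (hℓk : ℓ < k) {c : ℝ}
    (hc : 1 / ((k : ℝ) - ℓ) ≤ c) {r : ℕ → ℕ} (hr : IsColorCount (k - ℓ) c r)
    {p : ℕ → unitInterval} (hp : ∀ᶠ n in atTopMultiples (k - ℓ), 0 < (p n : ℝ))
    {κ A L η : ℝ} (hκ : 0 ≤ κ)
    (hκr : ∀ᶠ n in atTopMultiples (k - ℓ), (r n : ℝ) ^ (n / (k - ℓ)) ≤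
      κ ^ (n / (k - ℓ)) * (r n).descFactorial (n / (k - ℓ)))
    (hA : A = k * k.factorial ∨ A = 1 ∧ k - ℓ = 1) (hL : 1 < L) (hη : η < 1) {θ : ℕ → ℝ}
    (hθ : ∀ᶠ n : ℕ in atTopMultiples (k - ℓ),
      κ / p n * A * (Real.exp 1 / n) ^ (k - ℓ) ≤ θ n)
    (hθη : ∀ᶠ n : ℕ in atTopMultiples (k - ℓ), L * θ n *
      (1 + k * (k * k.factorial) * (Real.exp 1 / n) +
        k.factorial * Real.exp 1 ^ ℓ * ((n : ℝ) ^ 2 / (n : ℝ) ^ ℓ)) ≤ η)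
    (hθ0 : Tendsto (fun n : ℕ => θ n * ((n : ℝ) ^ 2 / (n : ℝ) ^ ℓ)) (atTopMultiples (k - ℓ)) (𝓝 0)) :
    WhpRainbow k ℓ r p := by
  unfold WhpRainbow
  have hcast : ((k - ℓ : ℕ) : ℝ) = (k : ℝ) - ℓ := Nat.cast_sub hℓk.le
  rw [← hcast] at hc
  have hd : 1 ≤ k - ℓ := by omega
  -- The 2 bounds 1 + y^k / L^(m/k - k); the rest is the constant in m times the weight of a single
  -- arc, divided by 1 - η.
  set K := 2 * (L * k.factorial * Real.exp 1 ^ ℓ / (1 - η)) with hK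
  have hlow : Tendsto (fun n : ℕ => 1 - K * (θ n * ((n : ℝ) ^ 2 / (n : ℝ) ^ ℓ)))
      (atTopMultiples (k - ℓ)) (𝓝 1) := by
    simpa using (hθ0.const_mul K).const_sub 1
  have hmain : ∀ᶠ n in atTopMultiples (k - ℓ),
      1 - K * (θ n * ((n : ℝ) ^ 2 / (n : ℝ) ^ ℓ)) ≤
        (randomColoredHypergraph k n (r n) (p n)).real {H | RainbowHamiltonian ℓ H} ∧
      (randomColoredHypergraph k n (r n) (p n)).real {H | RainbowHamiltonian ℓ H} ≤ 1 := by
    filter_upwards [hp, hκr, hθ, hθη, eventually_div_le_colorCount hd hc hr,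
      eventually_dvd_atTopMultiples (k - ℓ), eventually_ge_atTopMultiples (k - ℓ) (2 * k),
      (tendsto_div_atTopMultiples hd).eventually_ge_atTop k,
      (tendsto_cast_atTopMultiples (k - ℓ)).eventually_ge_atTop (Real.exp 1),
      eventually_pow_le_pow_div hd (show 1 ≤ k by omega) hL ((k - ℓ) * k)]
      with n hpn hκn hθ' hη' hmr hdn hn hkm hne hpow
    have : NeZero n := ⟨by omega⟩
    have : NeZero (r n) := ⟨by omega⟩
    refine ⟨?_, measureReal_le_one⟩
    set d := k - ℓ with hd_def
    set m := n / d with hm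
    have hnm : n = d * m := (Nat.mul_div_cancel' hdn).symm
    have hmn : m ≤ n := Nat.div_le_self _ _
    have hκ1 : 1 ≤ κ := by
      have h1 : ((r n).descFactorial m : ℝ) ≤ (r n : ℝ) ^ m := by
        exact_mod_cast Nat.descFactorial_le_pow _ _
      have hr0 : (0 : ℝ) < r n := by exact_mod_cast Nat.pos_of_ne_zero (NeZero.ne (r n))
      have h2 : 1 ≤ κ ^ m := by
        refine le_of_mul_le_mul_right ?_ (show 0 < (r n : ℝ) ^ m by positivity)
        rw [one_mul]
        exact hκn.trans (by gcongr)
      exact (one_le_pow_iff_of_nonneg hκ (by omega)).mp h2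
    set y := κ / (p n : ℝ) with hy
    have hy1 : 1 ≤ y := by
      rw [hy, le_div_iff₀ hpn, one_mul]
      exact (p n).2.2.trans hκ1
    have hstep : IsStepBound A k d (alignedArcs n k d m) := by
      rcases hA with h | ⟨h1, h2⟩
      · exact Or.inl h
      · rw [h1, h2]
        exact isStepBound_alignedArcs_one (by omega) hn
    have hA1 : 1 ≤ A := hstep.one_le (by omega)
    have hF := (sum_stepWeight_le (m := m) (Y := L * y) (B := L * θ n) hℓk hℓ hne hmn hA1
      (by positivity) (by
        rw [mul_assoc L, mul_assoc L]
        gcongr)).trans hη'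
    have hn0 : (0 : ℝ) < n := (Real.exp_pos 1).trans_le hne
    set x := Real.exp 1 / (n : ℝ) with hx
    have hx0 : 0 < x := by positivity
    have hyθ : y * x ^ d ≤ θ n := by
      refine le_trans ?_ hθ'
      rw [mul_right_comm]
      exact le_mul_of_one_le_right (by positivity) hA1
    have hθn : 0 ≤ θ n := le_trans (by positivity) hyθ
    have hθ1 : θ n ≤ 1 := by
      have h1 : θ n ≤ L * θ n := le_mul_of_one_le_left hθn hL.le
      have h2 : L * θ n ≤ L * θ n * (1 + k * (k * k.factorial) * x +
          k.factorial * Real.exp 1 ^ ℓ * ((n : ℝ) ^ 2 / (n : ℝ) ^ ℓ)) := by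
        refine le_mul_of_one_le_right (by positivity) ?_
        have : 0 ≤ k * (k * k.factorial) * x +
          k.factorial * Real.exp 1 ^ ℓ * ((n : ℝ) ^ 2 / (n : ℝ) ^ ℓ) := by positivity
        linarith
      linarith
    -- A polynomial bound on y suffices for `hc1`, since the exponential L^(m/k - k) then dominates
    -- y^k ≤ n^(dk).
    have hyn : y ≤ (n : ℝ) ^ d := by
      have h1 : y * x ^ d ≤ 1 := hyθ.trans hθ1
      rw [hx, div_pow, mul_div_assoc', div_le_one (by positivity)] at h1
      exact (le_mul_of_one_le_right (by positivity)
        (one_le_pow₀ (Real.one_le_exp zero_le_one))).trans h1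
    have hc1 : y ^ k / L ^ (m / k - k) ≤ 1 := by
      rw [div_le_one (by positivity)]
      refine le_trans ?_ hpow
      rw [pow_mul]
      gcongr
    have hsum := sum_pow_card_preservedArcs_le hnm hd (by omega) hkm hy1 hL.le hstep hF hη
    have hsec := two_sub_le_measureReal_rainbowHamiltonian hnm hℓ hℓk hn hpn hκ1 hmr hκn
    refine le_trans ?_ hsec
    have hfac : (0 : ℝ) < n.factorial := by exact_mod_cast Nat.factorial_pos n
    have h1 : (∑ π : Equiv.Perm (ZMod n), y ^ (preservedArcs k d m π).card) / n.factorial ≤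
        1 + K * (θ n * ((n : ℝ) ^ 2 / (n : ℝ) ^ ℓ)) := by
      rw [div_le_iff₀' hfac]
      refine hsum.trans ?_
      refine mul_le_mul_of_nonneg_left ?_ hfac.le
      have hmn' : (m : ℝ) ≤ n := by exact_mod_cast hmn
      have h1η : 0 < 1 - η := by linarith
      refine add_le_add_right ?_ 1
      calc (m : ℝ) * (1 + y ^ k / L ^ (m / k - k)) *
            (L * y * (m * k.factorial) * x ^ k / (1 - η))
          ≤ n * (1 + 1) * (L * y * (n * k.factorial) * x ^ k / (1 - η)) := by gcongr
        _ = n ^ 2 * 2 * (L * (y * x ^ d) * k.factorial * x ^ ℓ / (1 - η)) := by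
            rw [show x ^ k = x ^ d * x ^ ℓ by rw [← pow_add]; congr 1; omega]
            ring
        _ ≤ n ^ 2 * 2 * (L * θ n * k.factorial * x ^ ℓ / (1 - η)) := by gcongr
        _ = _ := by
            rw [hK, hx, div_pow]
            ring
    linarith
  exact tendsto_of_tendsto_of_tendsto_of_le_of_le' hlow tendsto_const_nhds
    (hmain.mono fun _ h => h.1) (hmain.mono fun _ h => h.2)

/-! ### The second moment method in the three ranges: ℓ ≥ 3, ℓ = 2, tight cycles -/

lemma tendsto_sq_div_pow_atTopMultiples (d : ℕ) {ℓ : ℕ} (hℓ : 3 ≤ ℓ) :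
    Tendsto (fun n : ℕ => (n : ℝ) ^ 2 / (n : ℝ) ^ ℓ) (atTopMultiples d) (𝓝 0) := by
  refine squeeze_zero' (Eventually.of_forall fun n => by positivity) ?_
    (tendsto_const_div_atTopMultiples d 1)
  filter_upwards [eventually_ge_atTopMultiples d 1] with n hn
  have hn1 : (1 : ℝ) ≤ n := by exact_mod_cast hn
  rw [div_le_div_iff₀ (by positivity) (by positivity), one_mul, ← pow_succ]
  exact pow_le_pow_right₀ hn1 hℓ

lemma tendsto_stepSum (k d ℓ : ℕ) {b : ℝ} (hb : Tendsto (fun n : ℕ => (n : ℝ) ^ 2 / (n : ℝ) ^ ℓ)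
    (atTopMultiples d) (𝓝 b)) :
    Tendsto (fun n : ℕ => 1 + k * (k * k.factorial) * (Real.exp 1 / n) +
      k.factorial * Real.exp 1 ^ ℓ * ((n : ℝ) ^ 2 / (n : ℝ) ^ ℓ)) (atTopMultiples d)
      (𝓝 (1 + k.factorial * Real.exp 1 ^ ℓ * b)) := by
  simpa using (((tendsto_const_div_atTopMultiples d (Real.exp 1)).const_mul
    ((k : ℝ) * (k * k.factorial))).const_add 1).add (hb.const_mul (k.factorial * Real.exp 1 ^ ℓ))

lemma eventually_pow_le_exp_pow_mul_descFactorial {d : ℕ} (hd : 1 ≤ d) {c : ℝ} {r : ℕ → ℕ}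
    (hc : 1 / (d : ℝ) ≤ c) (hr : IsColorCount d c r) :
    ∀ᶠ n in atTopMultiples d,
      (r n : ℝ) ^ (n / d) ≤ Real.exp 1 ^ (n / d) * (r n).descFactorial (n / d) := by
  filter_upwards [eventually_div_le_colorCount hd hc hr] with n hn
  rw [← Real.exp_nat_mul, mul_one]
  exact pow_le_exp_mul_descFactorial hn

lemma edgeProb_ratio_le {n d : ℕ} {κ A q K : ℝ} (hn : 0 < n) (hκ : 0 ≤ κ) (hA : 0 ≤ A)
    (hK : 0 < K) (hq : K / (n : ℝ) ^ d ≤ q) :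
    κ / q * A * (Real.exp 1 / n) ^ d ≤ κ * A * Real.exp 1 ^ d / K := by
  have hn0 : (0 : ℝ) < n := by exact_mod_cast hn
  have hq0 : 0 < q := lt_of_lt_of_le (by positivity) hq
  calc κ / q * A * (Real.exp 1 / n) ^ d
      ≤ κ / (K / (n : ℝ) ^ d) * A * (Real.exp 1 / n) ^ d := by gcongr
    _ = _ := by
      rw [div_pow]
      field_simp

/-- Taking κ = e, which is valid for every c, makes the constant depend on k alone. It is chosen so
that θ = 1/2 works; the step factors then sum to 3/2 · 1/2 = 3/4 in the limit, below η = 7/8. -/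
lemma whpRainbow_of_large_const {k ℓ : ℕ} (hℓ : 3 ≤ ℓ) (hℓk : ℓ < k) {c : ℝ}
    (hc : 1 / ((k : ℝ) - ℓ) ≤ c) {r : ℕ → ℕ} (hr : IsColorCount (k - ℓ) c r)
    {p : ℕ → unitInterval}
    (hp : ∀ᶠ n : ℕ in atTopMultiples (k - ℓ),
      2 * (k + 1) * k.factorial * Real.exp 1 ^ k / (n : ℝ) ^ (k - ℓ) ≤ (p n : ℝ)) :
    WhpRainbow k ℓ r p := by
  have hcast : ((k - ℓ : ℕ) : ℝ) = (k : ℝ) - ℓ := Nat.cast_sub hℓk.le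
  set K : ℝ := 2 * (k + 1) * k.factorial * Real.exp 1 ^ k with hK
  have hK0 : 0 < K := by positivity
  have hb := tendsto_sq_div_pow_atTopMultiples (k - ℓ) hℓ
  have hp' := hp.and (eventually_ge_atTopMultiples (k - ℓ) 1)
  refine whpRainbow_of_secondMoment (κ := Real.exp 1) (A := k * k.factorial) (L := 3 / 2)
    (η := 7 / 8) (θ := fun _ => 1 / 2) (by omega) hℓk hc hr ?_ (Real.exp_pos 1).le
    (eventually_pow_le_exp_pow_mul_descFactorial (by omega) (by rw [hcast]; exact hc) hr)
    (Or.inl rfl) (by norm_num) (by norm_num) ?_ ?_ ?_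
  · filter_upwards [hp'] with n hn
    have : (0 : ℝ) < n := by exact_mod_cast hn.2
    exact lt_of_lt_of_le (by positivity) hn.1
  · filter_upwards [hp'] with n hn
    refine (edgeProb_ratio_le (by omega) (Real.exp_pos 1).le (by positivity) hK0 hn.1).trans ?_
    rw [div_le_iff₀ hK0, hK]
    have h1 : Real.exp 1 * Real.exp 1 ^ (k - ℓ) ≤ Real.exp 1 ^ k := by
      rw [← pow_succ']
      exact pow_le_pow_right₀ (Real.one_le_exp zero_le_one) (by omega)
    calc Real.exp 1 * (k * k.factorial) * Real.exp 1 ^ (k - ℓ)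
        = k * k.factorial * (Real.exp 1 * Real.exp 1 ^ (k - ℓ)) := by ring
      _ ≤ (k + 1) * k.factorial * Real.exp 1 ^ k := by
          gcongr
          linarith
      _ = _ := by ring
  · have h := (tendsto_stepSum k (k - ℓ) ℓ hb).const_mul (3 / 2 * (1 / 2 : ℝ))
    exact h.eventually_le_const (by norm_num)
  · simpa using hb.const_mul (1 / 2 : ℝ)

/-- For ℓ = 2 the quotient n^2/n^ℓ is 1, so the smallness has to come from θ = B/ω → 0. -/
lemma whpRainbow_two {k : ℕ} (hk : 2 < k) {c : ℝ} (hc : 1 / ((k : ℝ) - 2) ≤ c) {r : ℕ → ℕ}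
    (hr : IsColorCount (k - 2) c r) {ω : ℕ → ℝ} (hω : Tendsto ω atTop atTop)
    {p : ℕ → unitInterval}
    (hp : ∀ᶠ n : ℕ in atTopMultiples (k - 2), ω n / (n : ℝ) ^ (k - 2) ≤ (p n : ℝ)) :
    WhpRainbow k 2 r p := by
  have hcast : ((k - 2 : ℕ) : ℝ) = (k : ℝ) - 2 := by
    have := Nat.cast_sub (R := ℝ) hk.le
    exact_mod_cast this
  have hω' := hω.mono_left (atTopMultiples_le_atTop (k - 2))
  have hb : Tendsto (fun n : ℕ => (n : ℝ) ^ 2 / (n : ℝ) ^ 2) (atTopMultiples (k - 2)) (𝓝 1) := by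
    refine tendsto_const_nhds.congr' ?_
    filter_upwards [eventually_ge_atTopMultiples (k - 2) 1] with n hn
    have : (n : ℝ) ≠ 0 := by positivity
    field_simp
  have hp' := hp.and ((eventually_ge_atTopMultiples (k - 2) 1).and (hω'.eventually_gt_atTop 0))
  set B := Real.exp 1 * (k * k.factorial) * Real.exp 1 ^ (k - 2) with hB
  have hθ : Tendsto (fun n => B / ω n) (atTopMultiples (k - 2)) (𝓝 0) := hω'.const_div_atTop B
  refine whpRainbow_of_secondMoment (κ := Real.exp 1) (A := k * k.factorial) (L := 2)
    (η := 1 / 2) (θ := fun n => B / ω n) (by omega) hk (by exact_mod_cast hc) hr ?_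
    (Real.exp_pos 1).le
    (eventually_pow_le_exp_pow_mul_descFactorial (by omega) (by rw [hcast]; exact hc) hr)
    (Or.inl rfl) (by norm_num) (by norm_num) ?_ ?_ ?_
  · filter_upwards [hp'] with n hn
    have h1 : (0 : ℝ) < n := by exact_mod_cast hn.2.1
    have h2 := hn.2.2
    exact lt_of_lt_of_le (by positivity) hn.1
  · filter_upwards [hp'] with n hn
    exact edgeProb_ratio_le (by omega) (Real.exp_pos 1).le (by positivity) hn.2.2 hn.1
  · have h := (hθ.const_mul 2).mul (tendsto_stepSum k (k - 2) 2 hb)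
    exact h.eventually_le_const (by simp)
  · simpa using hθ.mul hb

/-- With 1 + ε = e^(2δ), the choices κ = e^(1-R+δ) and A = 1 give θ = κe/K = e^(-δ). Then L =
e^(δ/2) leaves Lθ = e^(-δ/2) < 1, and η is the midpoint between this and 1. The assumption k ≥ 4
means ℓ = k - 1 ≥ 3, so the other step factors vanish in the limit. -/
lemma whpRainbow_tight {k : ℕ} (hk : 4 ≤ k) {c : ℝ} (hc : 1 ≤ c) {r : ℕ → ℕ}
    (hr : IsColorCount 1 c r) {ε : ℝ} (hε : 0 < ε) {p : ℕ → unitInterval}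
    (hp : ∀ᶠ n : ℕ in atTopMultiples 1, (1 + ε) * tightThreshold c n ≤ (p n : ℝ)) :
    WhpRainbow k (k - 1) r p := by
  have h1 : (k : ℝ) - ((k - 1 : ℕ) : ℝ) = 1 := by
    push_cast [show 1 ≤ k by omega]
    ring
  have hk1 : k - (k - 1) = 1 := by omega
  have hc' : 1 / ((k : ℝ) - ((k - 1 : ℕ) : ℝ)) ≤ c := by rw [h1]; simpa using hc
  set R := rainbowRate 1 c with hR
  have hthr : ∀ n, tightThreshold c n = Real.exp (2 - R) / (n : ℝ) ^ 1 := by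
    intro n
    rw [tightThreshold_eq k (by omega), rainbowThreshold_eq (by omega) hc', hk1, ← hR]
    norm_num
  set δ := Real.log (1 + ε) / 2 with hδ
  have hδ0 : 0 < δ := by
    have := Real.log_pos (show 1 < 1 + ε by linarith)
    positivity
  have hεδ : 1 + ε = Real.exp (2 * δ) := by
    rw [hδ, mul_div_cancel₀ _ two_ne_zero, Real.exp_log (by linarith)]
  set K := Real.exp (2 * δ + 2 - R) with hK
  have hp' : ∀ᶠ n : ℕ in atTopMultiples 1, K / (n : ℝ) ^ 1 ≤ (p n : ℝ) ∧ 1 ≤ n := by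
    filter_upwards [hp, eventually_ge_atTopMultiples 1 1] with n hn hn1
    refine ⟨le_trans (le_of_eq ?_) hn, hn1⟩
    rw [hthr, hεδ, mul_div_assoc', ← Real.exp_add, hK, add_sub_assoc]
  have hb := tendsto_sq_div_pow_atTopMultiples 1 (show 3 ≤ k - 1 by omega)
  have hlt : Real.exp (-(δ / 2)) < 1 := Real.exp_lt_one_iff.mpr (by linarith)
  refine whpRainbow_of_secondMoment (κ := Real.exp (1 - R + δ)) (A := 1) (L := Real.exp (δ / 2))
    (η := (Real.exp (-(δ / 2)) + 1) / 2) (θ := fun _ => Real.exp (-δ)) (by omega) (by omega) hc'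
    (by rw [hk1]; exact hr) ?_ (Real.exp_pos _).le ?_ (Or.inr ⟨rfl, hk1⟩)
    (Real.one_lt_exp_iff.mpr (by linarith)) (by linarith) ?_ ?_ ?_
  all_goals rw [hk1]
  · filter_upwards [hp'] with n hn
    have h1 : (0 : ℝ) < n := by exact_mod_cast hn.2
    exact lt_of_lt_of_le (by positivity) hn.1
  · have hc1 : 1 / ((1 : ℕ) : ℝ) ≤ c := by simpa using hc
    filter_upwards [eventually_log_descFactorial_div_pow le_rfl hc1 hr hδ0,
      eventually_div_le_colorCount le_rfl hc1 hr, hp'] with n hn hmr hn1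
    have hm1 : 1 ≤ n / 1 := by simpa using hn1.2
    set m := n / 1
    have hr0 : (0 : ℝ) < r n := by
      have : 0 < r n := by omega
      exact_mod_cast this
    have hD : (0 : ℝ) < (r n).descFactorial m := by
      exact_mod_cast Nat.pos_of_ne_zero (by rw [Ne, Nat.descFactorial_eq_zero_iff_lt]; omega)
    have h2 : Real.exp (-(m * (1 - R + δ))) ≤ (r n).descFactorial m / (r n : ℝ) ^ m := by
      rw [← Real.le_log_iff_exp_le (by positivity)]
      have := (abs_le.mp hn).1
      linarith
    rw [le_div_iff₀ (by positivity), Real.exp_neg, inv_mul_le_iff₀ (Real.exp_pos _)] at h2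
    rwa [← Real.exp_nat_mul]
  · filter_upwards [hp'] with n hn
    refine (edgeProb_ratio_le (by omega) (Real.exp_pos _).le zero_le_one
      (Real.exp_pos _) hn.1).trans (le_of_eq ?_)
    rw [mul_one, pow_one, ← Real.exp_add, ← Real.exp_sub]
    congr 1
    ring
  · have h := (tendsto_stepSum k 1 (k - 1) hb).const_mul (Real.exp (δ / 2) * Real.exp (-δ))
    refine h.eventually_le_const ?_
    rw [mul_zero, add_zero, mul_one, ← Real.exp_add, show δ / 2 + -δ = -(δ / 2) by ring]
    linarith
  · simpa using hb.const_mul (Real.exp (-δ))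

theorem theorem1p5 :
    -- (i)
    (∀ k ℓ : ℕ, 2 ≤ ℓ → ℓ < k → ∀ c : ℝ, 1 / ((k : ℝ) - ℓ) ≤ c →
      ∀ r : ℕ → ℕ, IsColorCount (k - ℓ) c r →
      ∀ ε : ℝ, 0 < ε → ∀ p : ℕ → unitInterval,
        (∀ᶠ n : ℕ in atTopMultiples (k - ℓ), (p n : ℝ) ≤ (1 - ε) * rainbowThreshold k ℓ c n) →
        WhpNotRainbow k ℓ r p) ∧
    -- (ii)
    (∀ k : ℕ, ∃ K : ℝ, 0 < K ∧ ∀ ℓ : ℕ, 3 ≤ ℓ → ℓ < k → ∀ c : ℝ, 1 / ((k : ℝ) - ℓ) ≤ c →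
      ∀ r : ℕ → ℕ, IsColorCount (k - ℓ) c r →
      ∀ p : ℕ → unitInterval,
        (∀ᶠ n : ℕ in atTopMultiples (k - ℓ), K / (n : ℝ) ^ (k - ℓ) ≤ (p n : ℝ)) →
        WhpRainbow k ℓ r p) ∧
    -- (iii)
    (∀ k : ℕ, 2 < k → ∀ c : ℝ, 1 / ((k : ℝ) - 2) ≤ c →
      ∀ r : ℕ → ℕ, IsColorCount (k - 2) c r →
      ∀ ω : ℕ → ℝ, Tendsto ω atTop atTop → ∀ p : ℕ → unitInterval,
        (∀ᶠ n : ℕ in atTopMultiples (k - 2), ω n / (n : ℝ) ^ (k - 2) ≤ (p n : ℝ)) →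
        WhpRainbow k 2 r p) ∧
    -- (iv)
    (∀ k : ℕ, 4 ≤ k → ∀ c : ℝ, 1 ≤ c → ∀ r : ℕ → ℕ, IsColorCount 1 c r →
      ∀ ε : ℝ, 0 < ε → ∀ p : ℕ → unitInterval,
        (∀ᶠ n : ℕ in atTopMultiples 1, (1 + ε) * tightThreshold c n ≤ (p n : ℝ)) →
        WhpRainbow k (k - 1) r p) ∧
    -- the resulting sharp threshold for rainbow tight Hamilton cycles
    (∀ k : ℕ, 4 ≤ k → ∀ c : ℝ, 1 ≤ c → ∀ r : ℕ → ℕ, IsColorCount 1 c r →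
      IsSharpThreshold k (k - 1) r (tightThreshold c)) := by
  refine ⟨?_, ?_, ?_, ?_, ?_⟩
  · intro k ℓ _ hℓk c hc r hr ε hε p hp
    exact whpNotRainbow_of_le hℓk hc hr hε hp
  · intro k
    refine ⟨2 * (k + 1) * k.factorial * Real.exp 1 ^ k, by positivity, ?_⟩
    intro ℓ hℓ hℓk c hc r hr p hp
    exact whpRainbow_of_large_const hℓ hℓk hc hr hp
  · intro k hk c hc r hr ω hω p hp
    exact whpRainbow_two hk hc hr hω hp
  · intro k hk c hc r hr ε hε p hp
    exact whpRainbow_tight hk hc hr hε hp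
  · intro k hk c hc r hr ε hε p
    have h1 : (k : ℝ) - ((k - 1 : ℕ) : ℝ) = 1 := by
      push_cast [show 1 ≤ k by omega]
      ring
    have hk1 : k - (k - 1) = 1 := by omega
    refine ⟨fun hp => ?_, fun hp => ?_⟩
    · refine whpNotRainbow_of_le (c := c) (by omega) (by rw [h1]; simpa using hc) (by rw [hk1]; exact hr)
        hε ?_
      rw [tightThreshold_eq k (by omega)] at hp
      exact hp
    · rw [hk1] at hp
      exact whpRainbow_tight hk hc hr hε hp
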